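/- Let $k$ be a field of characteristic $0$ and $(A,\mu_0)$ a commutative, associative, unital $k$-algebra. The Hochschild $n$-cochains are the $k$-multilinear maps $A^{n}\to A$; the Harrison complex $C=\bigoplus_n C^n$ consists of those cochains that vanish on all signed shuffle products $x\bullet y$ of two words $x,y$ of positive length. It carries the Gerstenhaber bracket $[f,g]_G=f\circ g-(-1)^{(m-1)(n-1)}g\circ f$ ($f\in C^m$, $g\in C^n$) and the differential $b=[\mu_0,\cdot\,]_G$ (the Hochschild coboundary up to sign). Its cohomology $H=\mathrm{Harr}^\bullet(A,A)$ carries the induced bracket $[\cdot,\cdot]_s$. Let $D=[\cdot,\cdot]_G[1]$ and $d=[\cdot,\cdot]_s[1]$ be the shifted, graded symmetric brackets, $D(x,y)=(-1)^{|x|}[x,y]_G$ on $C[2]$ and $d(x,y)=(-1)^{|x|}[x,y]_s$ on $H[2]$, and let $\overline{b+D}$ and $\overline d$ be the induced coderivations of the graded symmetric coalgebras $\mathrm{Sym}(C[2])$ and $\mathrm{Sym}(H[2])$. Call $A$ formal if there is a formality map, i.e. an $L_\infty$-quasi-isomorphism $\Phi:\mathrm{Sym}(H[2])\to\mathrm{Sym}(C[2])$: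 a morphism of (counital, coaugmented) graded coalgebras of degree $0$ with $\overline{b+D}\circ\Phi=\Phi\circ\overline d$, such that the restriction $\Phi_1:H[2]\to C[2]$ sends every class to a cocycle representing it. Theorem. Suppose that $A$ is formal. Let $\pi=\sum_{i\ge0}\lambda^i\pi_i\in\mathrm{Harr}^2(A,A)[[\lambda]]$ satisfy $[\pi,\pi]_s=0$, i.e. $\sum_{i+j=n}[\pi_i,\pi_j]_s=0$ for all $n$. Then there are $k$-bilinear maps $\mu_r:A\times A\to A$ ($r\ge1$) such that $\mu=\mu_0+\sum_{r\ge1}\lambda^r\mu_r$ is a formal commutative associative deformation of $A$, i.e. $f*g=\sum_{r\ge 0}\lambda^r\mu_r(f,g)$ (extended $\lambda$-bilinearly) is a commutative and associative product on $A[[\lambda]]$, and such that $\mu_1$ is a Harrison 2-cocycle whose cohomology class is $\pi_0$, the constant coefficient of $\pi$ (so $[\mu_1]=\pi$ if $\pi\in\mathrm{Harr}^2(A,A)$). -/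

import Mathlib

open scoped DirectSum TensorProduct

namespace Harrison

section Words

variable {A : Type*} [CommRing A]

/-- The sum of `G v w` over all decompositions `l = v ++ w` of a word (deconcatenation). -/
def splitSum (G : List A → List A → A) (l : List A) : A :=
  ∑ i ∈ Finset.range (l.length + 1), G (l.take i) (l.drop i)

/-- The Gerstenhaber composition of cochains: for a cochain `g` of degree `m`,
`(f ∘ g)(a₁, …, a_p) = ∑ i, (-1)^(i (m - 1)) f(a₁, …, aᵢ, g(aᵢ₊₁, …, aᵢ₊ₘ), aᵢ₊ₘ₊₁, …, a_p)`.
The sum runs over all subwords of length `j`, on which only the component of `g` of degree `j`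
contributes. -/
def circ (f g : List A → A) (l : List A) : A :=
  ∑ i ∈ Finset.range (l.length + 1), ∑ j ∈ Finset.range (l.length + 1 - i),
    (-1 : A) ^ (i * (j + 1)) * f (l.take i ++ g ((l.drop i).take j) :: l.drop (i + j))

/-- The value `f(x • y)` of a cochain on the signed shuffle product of two words, given by the
recursion `(a x) • (b y) = a (x • b y) + (-1)^(|x| + 1) b (a x • y)`. It is the sum of
`sgn(σ) f(σ.(x y))` over the `(p, q)`-shuffles `σ`, for `p = |x|` and `q = |y|`. -/
def onShuffle : (List A → A) → List A → List A → A
  | f, [], y => f y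
  | f, a :: x, [] => f (a :: x)
  | f, a :: x, b :: y =>
      onShuffle (fun l => f (a :: l)) x (b :: y) +
        (-1 : A) ^ (x.length + 1) * onShuffle (fun l => f (b :: l)) (a :: x) y
  termination_by _ x y => x.length + y.length

/-- The function `f` on words is additive in every letter. -/
structure IsAdd (f : List A → A) : Prop where
  add : ∀ u a b w, f (u ++ (a + b) :: w) = f (u ++ a :: w) + f (u ++ b :: w)

/-- The insertion of a cochain `g` into `F`, with sign `ε ^ i` for an insertion behind `i` letters;
this is a recursive form of `circ F g` for homogeneous `g`. -/
def ins (ε : A) (g : List A → A) : (List A → A) → List A → A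
  | F, [] => F [g []]
  | F, a :: l => splitSum (fun v w => F (g v :: w)) (a :: l) + ε * ins ε g (fun l => F (a :: l)) l

theorem splitSum_nil (G : List A → List A → A) : splitSum G [] = G [] [] := by
  simp [splitSum]

theorem splitSum_cons (G : List A → List A → A) (a : A) (l : List A) :
    splitSum G (a :: l) = G [] (a :: l) + splitSum (fun v w => G (a :: v) w) l := by
  simp only [splitSum, List.length_cons]
  rw [Finset.sum_range_succ']
  simp [add_comm]

theorem splitSum_congr {G G' : List A → List A → A} (l : List A)
    (h : ∀ v w, v ++ w = l → G v w = G' v w) : splitSum G l = splitSum G' l :=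
  Finset.sum_congr rfl fun _ _ => h _ _ (List.take_append_drop _ _)

theorem splitSum_add (G G' : List A → List A → A) (l : List A) :
    splitSum (fun v w => G v w + G' v w) l = splitSum G l + splitSum G' l :=
  Finset.sum_add_distrib

theorem splitSum_mul (c : A) (G : List A → List A → A) (l : List A) :
    splitSum (fun v w => c * G v w) l = c * splitSum G l :=
  (Finset.mul_sum _ _ _).symm

theorem splitSum_zero (l : List A) : splitSum (fun _ _ => (0 : A)) l = 0 :=
  Finset.sum_const_zero

theorem splitSum_assoc (K : List A → List A → List A → A) (l : List A) :
    splitSum (fun v w' => splitSum (fun v2 w => K v v2 w) w') l =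
      splitSum (fun v' w => splitSum (fun v1 v2 => K v1 v2 w) v') l := by
  induction l generalizing K with
  | nil => simp [splitSum_nil]
  | cons a l ih =>
    simp only [splitSum_cons, splitSum_nil]
    rw [ih]
    simp only [splitSum_add]
    ring

theorem IsAdd.cons {f : List A → A} (hf : IsAdd f) (a : A) : IsAdd fun l => f (a :: l) :=
  ⟨fun u b c w => hf.add (a :: u) b c w⟩

theorem IsAdd.head {f : List A → A} (hf : IsAdd f) (a b : A) (w : List A) :
    f ((a + b) :: w) = f (a :: w) + f (b :: w) := hf.add [] a b w

theorem IsAdd.zero {f : List A → A} (hf : IsAdd f) (u w : List A) : f (u ++ 0 :: w) = 0 := by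
  have := hf.add u 0 0 w
  simpa using this

theorem IsAdd.zero_head {f : List A → A} (hf : IsAdd f) (w : List A) : f (0 :: w) = 0 :=
  hf.zero [] w

/-- additive map in the head letter, as a homomorphism -/
def IsAdd.hom {f : List A → A} (hf : IsAdd f) (w : List A) : A →+ A where
  toFun a := f (a :: w)
  map_zero' := hf.zero_head w
  map_add' a b := hf.head a b w

theorem IsAdd.head_sign {f : List A → A} (hf : IsAdd f) {ε : A} (hε : ε = 1 ∨ ε = -1)
    (a : A) (w : List A) : f ((ε * a) :: w) = ε * f (a :: w) := by
  rcases hε with rfl | rfl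
  · simp
  · have := (hf.hom w).map_neg a
    simp only [IsAdd.hom, AddMonoidHom.coe_mk, ZeroHom.coe_mk] at this
    simpa using this

theorem ins_nil (ε : A) (g F : List A → A) : ins ε g F [] = F [g []] := by rw [ins]

theorem ins_cons (ε : A) (g F : List A → A) (a : A) (l : List A) :
    ins ε g F (a :: l) = splitSum (fun v w => F (g v :: w)) (a :: l) +
      ε * ins ε g (fun l => F (a :: l)) l := by rw [ins]

theorem ins_add (ε : A) (g F F' : List A → A) (l : List A) :
    ins ε g (fun l => F l + F' l) l = ins ε g F l + ins ε g F' l := by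
  induction l generalizing F F' with
  | nil => simp [ins_nil]
  | cons a l ih => simp only [ins_cons, ih, splitSum_add]; ring

theorem ins_mul (ε c : A) (g F : List A → A) (l : List A) :
    ins ε g (fun l => c * F l) l = c * ins ε g F l := by
  induction l generalizing F with
  | nil => simp [ins_nil]
  | cons a l ih => simp only [ins_cons, ih, splitSum_mul]; ring

theorem ins_zero (ε : A) (g : List A → A) (l : List A) :
    ins ε g (fun _ => 0) l = 0 := by
  simpa using ins_mul ε 0 g (fun _ => 0) l

/-- insertion commutes with additive maps -/
theorem ins_hom (ε : A) (hε : ε = 1 ∨ ε = -1) (g F : List A → A) (φ : A →+ A) (l : List A) :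
    ins ε g (fun l => φ (F l)) l = φ (ins ε g F l) := by
  induction l generalizing F with
  | nil => simp [ins_nil]
  | cons a l ih =>
    have h2 : ∀ x, ε * φ x = φ (ε * x) := by rcases hε with rfl | rfl <;> simp
    simp only [ins_cons, ih, map_add, h2, splitSum, map_sum]

theorem ins_splitSum (ε : A) (g : List A → A) (G : List A → List A → A) (l : List A) :
    ins ε g (splitSum G) l =
      splitSum (fun v w => ins ε g (fun x => G x w) v) l +
      splitSum (fun v w => ε ^ v.length * ins ε g (fun x => G v x) w) l := by
  induction l generalizing G with
  | nil => simp [ins_nil, splitSum_nil, splitSum_cons]; ring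
  | cons a l ih =>
    have e1 : (fun l => splitSum G (a :: l)) =
        fun l => G [] (a :: l) + splitSum (fun v w => G (a :: v) w) l := by
      funext l; rw [splitSum_cons]
    rw [ins_cons, e1, ins_add, ih]
    have e2 : splitSum (fun v w => splitSum G (g v :: w)) (a :: l) =
        splitSum (fun v w => G [] (g v :: w)) (a :: l) +
        splitSum (fun v' w => splitSum (fun v1 v2 => G (g v1 :: v2) w) v') (a :: l) := by
      rw [← splitSum_assoc, ← splitSum_add]
      simp only [splitSum_cons]
    rw [e2, splitSum_cons (fun v' w => splitSum (fun v1 v2 => G (g v1 :: v2) w) v'),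
      splitSum_cons (fun v w => ins ε g (fun x => G x w) v),
      splitSum_cons (fun v w => ε ^ v.length * ins ε g (fun x => G v x) w)]
    simp only [splitSum_nil, ins_nil, ins_cons, splitSum_add, splitSum_mul, List.length_cons,
      List.length_nil, pow_zero, pow_succ', mul_assoc]
    ring

/-- `g` is supported on words of length `n`, with `ε = (-1)^(n+1)`. -/
structure Homog (ε : A) (n : ℕ) (g : List A → A) : Prop where
  supp : ∀ l, l.length ≠ n → g l = 0
  sign : ε = (-1) ^ (n + 1)

theorem Homog.cases {ε : A} {n : ℕ} {g : List A → A} (h : Homog ε n g) : ε = 1 ∨ ε = -1 := by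
  rw [h.sign]; exact neg_one_pow_eq_or A _

theorem ins_ins_cons {φ γ : A} {m n : ℕ} {f g F : List A → A} (hF : IsAdd F) (hf : Homog φ m f)
    (hg : Homog γ n g) (κ : A) (hκ : κ = (-1) ^ ((m + 1) * (n + 1))) (a : A) (l : List A) :
    ins γ g (ins φ f F) (a :: l) =
      κ * γ * splitSum (fun v w => ins γ g (fun x => F (f v :: x)) w) (a :: l) +
      splitSum (fun v w => F (ins γ g f v :: w)) (a :: l) +
      φ * splitSum (fun v w => ins φ f (fun x => F (g v :: x)) w) (a :: l) +
      γ * φ * ins γ g (ins φ f (fun x => F (a :: x))) l := by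
  have key : ∀ v w, κ * γ * ins γ g (fun x => F (f v :: x)) w =
      γ ^ v.length * ins γ g (fun x => F (f v :: x)) w := by
    intro v w
    by_cases hv : v.length = m
    · rw [hv, hκ, hg.sign, ← pow_mul, ← pow_add]
      congr 1
      have : (m + 1) * (n + 1) + (n + 1) = (n + 1) * m + 2 * (n + 1) := by ring
      rw [this, pow_add, pow_mul (-1 : A) 2]; simp
    · have : (fun x => F (f v :: x)) = fun _ => 0 := by
        funext x; rw [hf.supp v hv, hF.zero_head]
      rw [this, ins_zero]; simp
  have e0 : ∀ (x : A) (w : List A), ins φ f F (x :: w) = F (f [] :: x :: w) +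
      splitSum (fun v1 w2 => F (f (x :: v1) :: w2)) w + φ * ins φ f (fun l => F (x :: l)) w := by
    intro x w; rw [ins_cons, splitSum_cons]
  have e1 : (fun l => ins φ f F (a :: l)) = fun l => F (f [] :: a :: l) +
      splitSum (fun v1 w2 => F (f (a :: v1) :: w2)) l + φ * ins φ f (fun l => F (a :: l)) l := by
    funext l; rw [e0]
  have e2 : ∀ v w, ins γ g (fun x => F (f (a :: x) :: w)) v =
      F (ins γ g (fun x => f (a :: x)) v :: w) := fun v w =>
    ins_hom γ hg.cases g (fun x => f (a :: x)) (hF.hom w) v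
  rw [ins_cons, e1, ins_add, ins_add, ins_mul, ins_splitSum]
  have e3 : splitSum (fun v w => F (ins γ g f v :: w)) (a :: l) =
      splitSum (fun v w => splitSum (fun v1 w2 => F (f (g v :: v1) :: w2)) w) (a :: l) +
      γ * splitSum (fun v w => F (ins γ g (fun x => f (a :: x)) v :: w)) l := by
    rw [splitSum_assoc (fun v v1 w2 => F (f (g v :: v1) :: w2)), splitSum_cons, splitSum_cons,
      add_assoc, ← splitSum_mul, ← splitSum_add, splitSum_nil, ins_nil]
    congr 1
    refine splitSum_congr _ fun v w _ => ?_
    rw [ins_cons, hF.head, hF.head_sign hg.cases]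
    congr 1
    exact (map_sum (hF.hom w) _ _)
  have e4 : κ * γ * splitSum (fun v w => ins γ g (fun x => F (f v :: x)) w) (a :: l) =
      ins γ g (fun x => F (f [] :: x)) (a :: l) + γ *
      splitSum (fun v w => γ ^ v.length * ins γ g (fun x => F (f (a :: v) :: x)) w) l := by
    rw [← splitSum_mul]
    simp only [key]
    rw [splitSum_cons, ← splitSum_mul]
    simp only [List.length_nil, pow_zero, one_mul, List.length_cons, pow_succ', mul_assoc]
  rw [e3, e4, ins_cons γ g (fun x => F (f [] :: x))]
  simp only [e0, e2, splitSum_add, splitSum_mul]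
  ring

/-- Commutator of two insertion operators. -/
theorem ins_comm {φ γ : A} {m n : ℕ} {f g F : List A → A} (hF : IsAdd F) (hf : Homog φ m f)
    (hg : Homog γ n g) (κ : A) (hκ : κ = (-1) ^ ((m + 1) * (n + 1))) (l : List A) :
    ins γ g (ins φ f F) l - κ * ins φ f (ins γ g F) l =
      ins (φ * γ) (fun l => ins γ g f l - κ * ins φ f g l) F l := by
  have hκ' : κ = 1 ∨ κ = -1 := by rw [hκ]; exact neg_one_pow_eq_or A _
  have hκ2 : κ * κ = 1 := by rcases hκ' with h | h <;> rw [h] <;> ring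
  have hsub : ∀ x y w, F ((x - κ * y) :: w) = F (x :: w) - κ * F (y :: w) := by
    intro x y w
    rw [← hF.head_sign hκ']
    exact map_sub (hF.hom w) _ _
  induction l generalizing F with
  | nil =>
    simp only [ins_nil, ins_cons, splitSum_cons, splitSum_nil, hsub]
    rw [hf.sign, hg.sign, hκ]
    by_cases hm : m = 0
    · by_cases hn : n = 0
      · subst hm hn; simp; ring
      · rw [hg.supp [] (fun h => hn h.symm)]
        have := hF.zero [f []] []
        have h0 := hF.zero_head [f []]
        simp only [List.singleton_append] at this
        simp [this, h0]
    · rw [hf.supp [] (fun h => hm h.symm)]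
      have := hF.zero [g []] []
      have h0 := hF.zero_head [g []]
      simp only [List.singleton_append] at this
      simp [this, h0]
  | cons a l ih =>
    rw [ins_ins_cons hF hf hg κ hκ, ins_ins_cons hF hg hf κ (by rw [hκ, mul_comm]), ins_cons,
      ← ih (hF.cons a) fun x y w => (by
        have := hF.add [a] x (-κ * y) w
        rw [← (hF.cons a).head_sign hκ']
        exact map_sub ((hF.cons a).hom w) _ _)]
    simp only [hsub]
    have : ∀ (G G' : List A → List A → A) l, splitSum (fun v w => G v w - κ * G' v w) l =
        splitSum G l - κ * splitSum G' l := by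
      intro G G' l
      rw [← splitSum_mul]; exact Finset.sum_sub_distrib _ _
    rw [this]
    linear_combination (-φ * splitSum (fun v w => ins φ f (fun x => F (g v :: x)) w) (a :: l)) * hκ2

theorem onShuffle_nil_left (f : List A → A) (y : List A) : onShuffle f [] y = f y := by
  rw [onShuffle]

theorem onShuffle_nil_right (f : List A → A) (x : List A) : onShuffle f x [] = f x := by
  cases x <;> rw [onShuffle]

theorem onShuffle_cons (f : List A → A) (a : A) (x : List A) (b : A) (y : List A) :
    onShuffle f (a :: x) (b :: y) = onShuffle (fun l => f (a :: l)) x (b :: y) +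
        (-1 : A) ^ (x.length + 1) * onShuffle (fun l => f (b :: l)) (a :: x) y := by
  rw [onShuffle]

theorem onShuffle_add (f f' : List A → A) (x y : List A) :
    onShuffle (fun l => f l + f' l) x y = onShuffle f x y + onShuffle f' x y := by
  induction x generalizing f f' y with
  | nil => simp [onShuffle_nil_left]
  | cons a x ih =>
    induction y generalizing f f' with
    | nil => simp [onShuffle_nil_right]
    | cons b y ih' => simp only [onShuffle_cons, ih, ih']; ring

theorem onShuffle_mul (c : A) (f : List A → A) (x y : List A) :
    onShuffle (fun l => c * f l) x y = c * onShuffle f x y := by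
  induction x generalizing f y with
  | nil => simp [onShuffle_nil_left]
  | cons a x ih =>
    induction y generalizing f with
    | nil => simp [onShuffle_nil_right]
    | cons b y ih' => simp only [onShuffle_cons, ih, ih']; ring

theorem onShuffle_hom (φ : A →+ A) (f : List A → A) (x y : List A) :
    onShuffle (fun l => φ (f l)) x y = φ (onShuffle f x y) := by
  have h2 : ∀ (n : ℕ) x, (-1) ^ n * φ x = φ ((-1) ^ n * x) := by
    intro n x; rcases neg_one_pow_eq_or A n with h | h <;> simp [h]
  induction x generalizing f y with
  | nil => simp [onShuffle_nil_left]
  | cons a x ih =>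
    induction y generalizing f with
    | nil => simp [onShuffle_nil_right]
    | cons b y ih' => simp only [onShuffle_cons, ih, ih', h2, map_add]

theorem onShuffle_zero (x y : List A) : onShuffle (fun _ => (0 : A)) x y = 0 := by
  simpa using onShuffle_mul 0 (fun _ => (0 : A)) x y

theorem onShuffle_congr {f f' : List A → A} (x y : List A)
    (h : ∀ l, l.length = x.length + y.length → f l = f' l) :
    onShuffle f x y = onShuffle f' x y := by
  induction x generalizing f f' y with
  | nil => simpa [onShuffle_nil_left] using h y (by simp)
  | cons a x ih =>
    induction y generalizing f f' with
    | nil => simpa [onShuffle_nil_right] using h (a :: x) (by simp)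
    | cons b y ih' =>
      rw [onShuffle_cons, onShuffle_cons, ih (f' := fun l => f' (a :: l)),
        ih' (f' := fun l => f' (b :: l))]
      · intro l hl; apply h; simp at hl ⊢; omega
      · intro l hl; apply h; simp at hl ⊢; omega

/-- compatibility of the shuffle product with deconcatenation -/
theorem onShuffle_splitSum (G : List A → List A → A) (x y : List A) :
    onShuffle (splitSum G) x y =
      splitSum (fun x' x'' => splitSum (fun y' y'' => (-1) ^ (x''.length * y'.length) *
        onShuffle (fun p => onShuffle (G p) x'' y'') x' y') y) x := by
  induction x generalizing G y with
  | nil => simp [onShuffle_nil_left, splitSum_nil]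
  | cons a x ih =>
    induction y generalizing G with
    | nil => simp [onShuffle_nil_right, splitSum_nil]
    | cons b y ih' =>
      have e1 : ∀ c, (fun l => splitSum G (c :: l)) =
          fun l => G [] (c :: l) + splitSum (fun v w => G (c :: v) w) l := by
        intro c; funext l; rw [splitSum_cons]
      rw [onShuffle_cons, e1, e1, onShuffle_add, onShuffle_add]
      have i1 := ih (fun v w => G (a :: v) w) (b :: y)
      have i2 := ih' (fun v w => G (b :: v) w)
      rw [show (splitSum fun v w => G (a :: v) w) = fun l => splitSum (fun v w => G (a :: v) w) l
        from rfl] at i1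
      rw [show (splitSum fun v w => G (b :: v) w) = fun l => splitSum (fun v w => G (b :: v) w) l
        from rfl] at i2
      rw [i1, i2]
      have e3 : splitSum (fun x' x'' => splitSum (fun y' y'' =>
            (-1) ^ (x''.length * (y'.length + 1)) * ((-1) ^ (x'.length + 1) *
              onShuffle (fun p => onShuffle (G (b :: p)) x'' y'') (a :: x') y')) y) x =
          (-1) ^ (x.length + 1) * splitSum (fun x' x'' => splitSum (fun y' y'' =>
            (-1) ^ (x''.length * y'.length) *
              onShuffle (fun p => onShuffle (G (b :: p)) x'' y'') (a :: x') y') y) x := by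
        rw [← splitSum_mul]
        refine splitSum_congr _ fun x' x'' hx => ?_
        rw [← splitSum_mul]
        refine splitSum_congr _ fun y' y'' _ => ?_
        have hl : x.length = x'.length + x''.length := by rw [← hx, List.length_append]
        rw [hl]; ring
      simp only [splitSum_cons, onShuffle_nil_left, onShuffle_nil_right, onShuffle_cons,
        List.length_cons, List.length_nil, mul_zero, pow_zero, one_mul, mul_add (_ ^ _),
        splitSum_add, e3]
      rw [← splitSum_mul ((-1) ^ (x.length + 1))
        (fun v w => (-1) ^ ((x.length + 1) * v.length) * onShuffle (G (b :: v)) (a :: x) w)]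
      have e4 : splitSum (fun v w => (-1) ^ ((x.length + 1) * (v.length + 1)) *
          onShuffle (G (b :: v)) (a :: x) w) y = splitSum (fun v w => (-1) ^ (x.length + 1) *
          ((-1) ^ ((x.length + 1) * v.length) * onShuffle (G (b :: v)) (a :: x) w)) y := by
        refine splitSum_congr _ fun y' y'' _ => ?_
        ring
      simp only [e4]
      ring

theorem onShuffle_zero_left {F : List A → A} (hF : ∀ u w, F (u ++ 0 :: w) = 0) (u w y : List A) :
    onShuffle F (u ++ 0 :: w) y = 0 := by
  have h0 : ∀ {F : List A → A}, (∀ u w, F (u ++ 0 :: w) = 0) → (fun l => F (0 :: l)) = fun _ => 0 :=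
    fun hF => funext fun l => hF [] l
  induction u generalizing F y with
  | nil =>
    induction y generalizing F with
    | nil => rw [onShuffle_nil_right]; exact hF _ _
    | cons b y ih =>
      rw [List.nil_append, onShuffle_cons, h0 hF, onShuffle_zero]
      have := ih (F := fun l => F (b :: l)) fun u w => hF (b :: u) w
      rw [List.nil_append] at this
      rw [this]; simp
  | cons a u ih =>
    induction y generalizing F with
    | nil => rw [onShuffle_nil_right]; exact hF _ _
    | cons b y ih' =>
      rw [List.cons_append, onShuffle_cons, ih fun u w => hF (a :: u) w]
      have := ih' (F := fun l => F (b :: l)) fun u w => hF (b :: u) w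
      rw [List.cons_append] at this
      rw [this]; simp

theorem onShuffle_zero_right {F : List A → A} (hF : ∀ u w, F (u ++ 0 :: w) = 0) (x : List A) :
    onShuffle F x [0] = 0 := by
  induction x generalizing F with
  | nil => rw [onShuffle_nil_left]; exact hF [] []
  | cons a x ih =>
    rw [onShuffle_cons, ih fun u w => hF (a :: u) w, onShuffle_nil_right]
    rw [show F (0 :: a :: x) = 0 from hF [] (a :: x)]; simp

/-- insertion into a function twisted by the length -/
theorem ins_sign {γ : A} {n : ℕ} {g F : List A → A} (hg : Homog γ n g)
    (hF : ∀ u w, F (u ++ 0 :: w) = 0) (l : List A) :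
    ins γ g (fun l => (-1) ^ l.length * F l) l = γ * (-1) ^ l.length * ins γ g F l := by
  have key : ∀ {F : List A → A}, (∀ u w, F (u ++ 0 :: w) = 0) → ∀ v w,
      (-1) ^ (w.length + 1) * F (g v :: w) = γ * (-1) ^ (v ++ w).length * F (g v :: w) := by
    intro F hF v w
    by_cases hv : v.length = n
    · rw [hg.sign, List.length_append, hv]
      have : (-1 : A) ^ (n + n) = 1 := by rw [← two_mul, pow_mul]; simp
      linear_combination ((-1) ^ w.length * F (g v :: w)) * this
    · rw [hg.supp v hv, show F (0 :: w) = 0 from hF [] w]; simp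
  induction l generalizing F with
  | nil =>
    rw [ins_nil, ins_nil]
    simpa using key hF [] []
  | cons a l ih =>
    rw [ins_cons, ins_cons, mul_add, ← splitSum_mul]
    congr 1
    · refine splitSum_congr _ fun v w h => ?_
      rw [← h, ← key hF v w, List.length_cons]
    · have : (fun l => (-1) ^ (a :: l).length * F (a :: l)) =
          fun l => (-1) * ((-1) ^ l.length * F (a :: l)) := by
        funext l; rw [List.length_cons]; ring
      rw [this, ins_mul, ih fun u w => hF (a :: u) w, List.length_cons]
      ring

theorem onShuffle_prefix {g F : List A → A} (hF : IsAdd F) (h0 : g [] = 0)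
    (hs : ∀ x y, x ≠ [] → y ≠ [] → onShuffle g x y = 0) (a : A) (x : List A) (b : A) (y : List A) :
    onShuffle (splitSum fun v w => F (g v :: w)) (a :: x) (b :: y) =
      splitSum (fun v w => onShuffle (fun l => F (g v :: l)) w (b :: y)) (a :: x) +
      splitSum (fun v w => (-1) ^ ((x.length + 1) * v.length) *
        onShuffle (fun l => F (g v :: l)) (a :: x) w) (b :: y) := by
  have hK : ∀ x' x'' y' y'', onShuffle (fun p => onShuffle (fun l => F (g p :: l)) x'' y'') x' y' =
      onShuffle (fun l => F (onShuffle g x' y' :: l)) x'' y'' := by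
    intro x' x'' y' y''
    let φ : A →+ A :=
      { toFun := fun z => onShuffle (fun l => F (z :: l)) x'' y''
        map_zero' := by
          rw [show (fun l => F (0 :: l)) = fun _ => 0 from funext fun l => hF.zero_head l,
            onShuffle_zero]
        map_add' := fun z z' => by
          rw [← onShuffle_add]; congr 1; funext l; exact hF.head z z' l }
    exact onShuffle_hom φ g x' y'
  have hz : (fun l => F (0 :: l)) = fun _ => 0 := funext fun l => hF.zero_head l
  rw [onShuffle_splitSum]
  simp only [hK]
  simp only [splitSum_cons, onShuffle_nil_left, onShuffle_nil_right, h0, hz, onShuffle_zero,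
    hs (_ :: _) (_ :: _) (List.cons_ne_nil _ _) (List.cons_ne_nil _ _), mul_zero, splitSum_zero,
    List.length_cons, List.length_nil, pow_zero, one_mul, add_zero, zero_add]
  ring

/-- A cochain vanishing on shuffles acts as a derivation of the shuffle product. -/
theorem onShuffle_ins {γ : A} {n : ℕ} {g F : List A → A} (hg : Homog γ n g) (hF : IsAdd F)
    (h0 : g [] = 0) (hs : ∀ x y, x ≠ [] → y ≠ [] → onShuffle g x y = 0) (x y : List A) :
    onShuffle (ins γ g F) x y = ins γ g (fun l => onShuffle F l y) x +
      γ ^ x.length * ins γ g (fun l => onShuffle F x l) y := by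
  have hγ2 : γ * γ = 1 := by rcases hg.cases with h | h <;> rw [h] <;> ring
  induction x generalizing F y with
  | nil =>
    rw [onShuffle_nil_left, ins_nil, h0]
    have := onShuffle_zero_left hF.zero [] [] y
    rw [List.nil_append] at this
    simp only [onShuffle_nil_left, this]
    simp
  | cons a x ih =>
    induction y generalizing F with
    | nil =>
      rw [onShuffle_nil_right, ins_nil, h0, onShuffle_zero_right hF.zero]
      simp only [onShuffle_nil_right]
      simp
    | cons b y ih' =>
      have e1 : ∀ c, (fun l => ins γ g F (c :: l)) = fun l =>
          splitSum (fun v w => F (g v :: w)) (c :: l) + γ * ins γ g (fun l => F (c :: l)) l := by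
        intro c; funext l; rw [ins_cons]
      have eL : onShuffle (ins γ g F) (a :: x) (b :: y) =
          onShuffle (splitSum fun v w => F (g v :: w)) (a :: x) (b :: y) +
          γ * (onShuffle (ins γ g fun l => F (a :: l)) x (b :: y) +
            (-1) ^ (x.length + 1) * onShuffle (ins γ g fun l => F (b :: l)) (a :: x) y) := by
        rw [onShuffle_cons, e1, e1, onShuffle_add, onShuffle_add, onShuffle_mul, onShuffle_mul,
          onShuffle_cons (splitSum fun v w => F (g v :: w))]
        ring
      have hFb := hF.cons b
      have hz : (fun l => F (b :: 0 :: l)) = fun _ => 0 := funext fun l => hFb.zero_head l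
      have R1 : ins γ g (fun l => onShuffle F l (b :: y)) (a :: x) =
          splitSum (fun v w => onShuffle (fun l => F (g v :: l)) w (b :: y)) (a :: x) +
          γ * ins γ g (fun l => onShuffle (fun l => F (a :: l)) l (b :: y)) x +
          (-1) ^ (x.length + 1) * γ *
            ins γ g (fun l => onShuffle (fun l => F (b :: l)) l y) (a :: x) := by
        rw [ins_cons, ins_cons]
        simp only [onShuffle_cons, splitSum_add, ins_add]
        have s2 : splitSum (fun v w => (-1) ^ (w.length + 1) *
              onShuffle (fun l => F (b :: l)) (g v :: w) y) (a :: x) =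
            (-1) ^ (x.length + 1) * γ *
              splitSum (fun v w => onShuffle (fun l => F (b :: l)) (g v :: w) y) (a :: x) := by
          rw [← splitSum_mul]
          refine splitSum_congr _ fun v w h => ?_
          by_cases hv : v.length = n
          · have hl : x.length + 1 = n + w.length := by
              rw [← hv, ← List.length_append, h, List.length_cons]
            rw [hl, hg.sign]
            have : (-1 : A) ^ (n + n) = 1 := by rw [← two_mul, pow_mul]; simp
            linear_combination (norm := ring_nf)
              (((-1) ^ w.length * onShuffle (fun l => F (b :: l)) (g v :: w) y)) * this
          · have := onShuffle_zero_left (F := fun l => F (b :: l)) hFb.zero [] w y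
            rw [List.nil_append] at this
            rw [hg.supp v hv, this]; simp
        have s4 : ins γ g (fun l => (-1) ^ (l.length + 1) *
              onShuffle (fun l => F (b :: l)) (a :: l) y) x =
            (-1) ^ (x.length + 1) * γ *
              ins γ g (fun l => onShuffle (fun l => F (b :: l)) (a :: l) y) x := by
          have : (fun l : List A => (-1) ^ (l.length + 1) *
              onShuffle (fun l => F (b :: l)) (a :: l) y) =
              fun l => (-1) * ((-1) ^ l.length * onShuffle (fun l => F (b :: l)) (a :: l) y) := by
            funext l; ring
          rw [this, ins_mul, ins_sign hg fun u w => onShuffle_zero_left (F := fun l => F (b :: l)) hFb.zero (a :: u) w y]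
          ring
        rw [s2, s4]
        ring
      have R2 : γ ^ (x.length + 1) * ins γ g (fun l => onShuffle F (a :: x) l) (b :: y) =
          splitSum (fun v w => (-1) ^ ((x.length + 1) * v.length) *
            onShuffle (fun l => F (g v :: l)) (a :: x) w) (b :: y) +
          γ ^ (x.length + 1) * ins γ g (fun l => onShuffle (fun l => F (a :: l)) x l) (b :: y) +
          γ ^ (x.length + 1) * γ * (-1) ^ (x.length + 1) *
            ins γ g (fun l => onShuffle (fun l => F (b :: l)) (a :: x) l) y := by
        rw [ins_cons, ins_cons]
        simp only [onShuffle_cons, splitSum_add, ins_add, ins_mul, splitSum_mul]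
        have s : splitSum (fun v w => (-1) ^ ((x.length + 1) * v.length) *
            onShuffle (fun l => F (g v :: l)) (a :: x) w) (b :: y) =
            γ ^ (x.length + 1) * (-1) ^ (x.length + 1) *
              splitSum (fun v w => onShuffle (fun l => F (g v :: l)) (a :: x) w) (b :: y) := by
          rw [← splitSum_mul]
          refine splitSum_congr _ fun v w _ => ?_
          by_cases hv : v.length = n
          · rw [hv, hg.sign, ← pow_mul, ← pow_add]
            have : (n + 1) * (x.length + 1) + (x.length + 1) =
              (x.length + 1) * n + 2 * (x.length + 1) := by ring
            rw [this, pow_add _ _ (2 * _), pow_mul (-1 : A) 2]; simp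
          · rw [hg.supp v hv, show (fun l => F (0 :: l)) = fun _ => 0 from
              funext fun l => hF.zero_head l, onShuffle_zero]; simp
        rw [s]
        ring
      rw [eL, onShuffle_prefix hF h0 hs, ih (hF.cons a), ih' (hF.cons b),
        List.length_cons, R1, R2]
      ring

theorem ins_congr {ε : A} {g F F' : List A → A} (l : List A) (h : ∀ l, l ≠ [] → F l = F' l) :
    ins ε g F l = ins ε g F' l := by
  cases l with
  | nil => rw [ins_nil, ins_nil, h _ (List.cons_ne_nil _ _)]
  | cons a l =>
    rw [ins_cons, ins_cons]
    congr 1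
    · exact splitSum_congr _ fun v w _ => h _ (List.cons_ne_nil _ _)
    · congr 2; funext l; exact h _ (List.cons_ne_nil _ _)

/-- Closure of cochains vanishing on shuffles under insertion. -/
theorem onShuffle_ins_eq_zero {γ : A} {n : ℕ} {f g : List A → A} (hg : Homog γ n g)
    (hf : IsAdd f) (hsf : ∀ x y, x ≠ [] → y ≠ [] → onShuffle f x y = 0)
    (hs : ∀ x y, x ≠ [] → y ≠ [] → onShuffle g x y = 0) (x y : List A) (hx : x ≠ []) (hy : y ≠ []) :
    onShuffle (ins γ g f) x y = 0 := by
  by_cases hn : n = 0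
  · have key : ∀ {f : List A → A}, IsAdd f → ∀ l, ins γ g f l = onShuffle f [g []] l := by
      intro f hf l
      induction l generalizing f with
      | nil => rw [ins_nil, onShuffle_nil_right]
      | cons a l ih =>
        have hz : ∀ v w, f (g (a :: v) :: w) = 0 := fun v w => by
          rw [hg.supp (a :: v) (by simp [hn]), hf.zero_head]
        rw [ins_cons, onShuffle_cons, onShuffle_nil_left, ih (hf.cons a), splitSum_cons, hg.sign, hn]
        simp [hz, splitSum_zero]
    rw [onShuffle_congr (f' := fun _ => 0), onShuffle_zero]
    intro l hl
    rw [key hf]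
    refine hsf _ _ (List.cons_ne_nil _ _) ?_
    rintro rfl
    exact hx (List.length_eq_zero_iff.1 (by simp at hl; omega))
  · have h0 : g [] = 0 := hg.supp [] fun h => hn h.symm
    rw [onShuffle_ins hg hf h0 hs, ins_congr (F' := fun _ => 0) x fun l hl => hsf l y hl hy,
      ins_congr (F' := fun _ => 0) y fun l hl => hsf x l hx hl, ins_zero, ins_zero]
    simp

end Words

section Words2

variable {A : Type*} [CommRing A]

theorem circ_cons {ε : A} {n : ℕ} {f g : List A → A} (hf : IsAdd f) (hg : Homog ε n g)
    (a : A) (l : List A) : circ f g (a :: l) = splitSum (fun v w => f (g v :: w)) (a :: l) +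
      ε * circ (fun l => f (a :: l)) g l := by
  rw [circ, Finset.sum_range_succ', add_comm]
  congr 1
  · simp [splitSum]
  · rw [circ, Finset.mul_sum]
    refine Finset.sum_congr (by simp) fun i hi => ?_
    rw [Finset.mul_sum]
    refine Finset.sum_congr (by simp) fun j hj => ?_
    simp only [List.drop_succ_cons, List.take_succ_cons, List.cons_append,
      show i + 1 + j = i + j + 1 by ring]
    by_cases hv : ((l.drop i).take j).length = n
    · have hjn : j = n := by
        simp only [List.length_take, List.length_drop, Finset.mem_range] at hv hi hj
        omega
      rw [hjn, hg.sign]; ring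
    · have h0 : f (a :: (l.take i ++ 0 :: l.drop (i + j))) = 0 := hf.zero (a :: l.take i) _
      rw [hg.supp _ hv, h0]; simp

theorem circ_eq_ins {ε : A} {n : ℕ} {f g : List A → A} (hf : IsAdd f) (hg : Homog ε n g)
    (l : List A) : circ f g l = ins ε g f l := by
  induction l generalizing f with
  | nil => simp [circ, ins_nil]
  | cons a l ih => rw [circ_cons hf hg, ins_cons, ih (hf.cons a)]


variable (k : Type*) [Field k] [Algebra k A]

/-- The function `f` on words is `k`-linear in every letter. -/
structure IsMultilinear (f : List A → A) : Prop where
  map_add : ∀ u a b w, f (u ++ (a + b) :: w) = f (u ++ a :: w) + f (u ++ b :: w)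
  map_smul : ∀ u (c : k) a w, f (u ++ (c • a) :: w) = c • f (u ++ a :: w)

variable {k}

theorem IsMultilinear.isAdd {f : List A → A} (hf : IsMultilinear k f) : IsAdd f := ⟨hf.map_add⟩

theorem IsMultilinear.cons {f : List A → A} (hf : IsMultilinear k f) (a : A) :
    IsMultilinear k fun l => f (a :: l) :=
  ⟨fun u b c w => hf.map_add (a :: u) b c w, fun u b c w => hf.map_smul (a :: u) b c w⟩

theorem splitSum_map_add (G : List A → List A → A)
    (h1 : ∀ v u a b w, G (u ++ (a + b) :: w) v = G (u ++ a :: w) v + G (u ++ b :: w) v)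
    (h2 : ∀ v u a b w, G v (u ++ (a + b) :: w) = G v (u ++ a :: w) + G v (u ++ b :: w))
    (u : List A) (a b : A) (w : List A) : splitSum G (u ++ (a + b) :: w) =
      splitSum G (u ++ a :: w) + splitSum G (u ++ b :: w) := by
  induction u generalizing G with
  | nil =>
    have := h2 [] [] a b w
    simp only [List.nil_append] at this ⊢
    have h3 : splitSum (fun v w => G ((a + b) :: v) w) w =
        splitSum (fun v x => G (a :: v) x + G (b :: v) x) w :=
      splitSum_congr w fun v x _ => h1 x [] a b v
    rw [splitSum_cons, splitSum_cons, splitSum_cons, this, h3, splitSum_add]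
    ring
  | cons c u ih =>
    have := h2 [] (c :: u) a b w
    simp only [List.cons_append] at this ⊢
    rw [splitSum_cons, splitSum_cons, splitSum_cons, this,
      ih (fun v w => G (c :: v) w) (fun v u a b w => h1 v (c :: u) a b w)
        (fun v u a b w => h2 (c :: v) u a b w)]
    ring

theorem splitSum_map_smul (G : List A → List A → A) (c : k)
    (h1 : ∀ v u a w, G (u ++ (c • a) :: w) v = c • G (u ++ a :: w) v)
    (h2 : ∀ v u a w, G v (u ++ (c • a) :: w) = c • G v (u ++ a :: w))
    (u : List A) (a : A) (w : List A) : splitSum G (u ++ (c • a) :: w) =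
      c • splitSum G (u ++ a :: w) := by
  induction u generalizing G with
  | nil =>
    have := h2 [] [] a w
    simp only [List.nil_append] at this ⊢
    have h3 : splitSum (fun v w => G ((c • a) :: v) w) w =
        splitSum (fun v x => c • G (a :: v) x) w :=
      splitSum_congr w fun v x _ => h1 x [] a v
    rw [splitSum_cons, splitSum_cons, this, smul_add, h3]
    congr 1
    exact Finset.smul_sum.symm
  | cons d u ih =>
    have := h2 [] (d :: u) a w
    simp only [List.cons_append] at this ⊢
    rw [splitSum_cons, splitSum_cons, this,
      ih (fun v w => G (d :: v) w) (fun v u a w => h1 v (d :: u) a w)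
        (fun v u a w => h2 (d :: v) u a w), smul_add]

theorem ins_smul (ε : A) (g F : List A → A) (c : k) (l : List A) :
    ins ε g (fun l => c • F l) l = c • ins ε g F l := by
  simp only [Algebra.smul_def]
  exact ins_mul ε (algebraMap k A c) g F l

theorem isMultilinear_ins (ε : A) {f g : List A → A} (hf : IsMultilinear k f)
    (hg : IsMultilinear k g) : IsMultilinear k (ins ε g f) := by
  constructor
  · intro u a b w
    have key : ∀ {f : List A → A}, IsMultilinear k f → ∀ u a b w,
        splitSum (fun v w => f (g v :: w)) (u ++ (a + b) :: w) =
        splitSum (fun v w => f (g v :: w)) (u ++ a :: w) +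
        splitSum (fun v w => f (g v :: w)) (u ++ b :: w) := fun hf =>
      splitSum_map_add _ (fun v u a b w => by rw [hg.map_add]; exact hf.map_add [] _ _ _)
        (fun v u a b w => (hf.cons (g v)).map_add u a b w)
    induction u generalizing f with
    | nil =>
      have h := key hf [] a b w
      simp only [List.nil_append] at h ⊢
      rw [ins_cons, ins_cons, ins_cons, h,
        show (fun l => f ((a + b) :: l)) = fun l => f (a :: l) + f (b :: l) from
          funext fun l => hf.map_add [] a b l, ins_add]
      ring
    | cons c u ih =>
      have h := key hf (c :: u) a b w
      simp only [List.cons_append] at h ⊢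
      rw [ins_cons, ins_cons, ins_cons, h, ih (hf.cons c)]
      ring
  · intro u c a w
    have key : ∀ {f : List A → A}, IsMultilinear k f → ∀ u a w,
        splitSum (fun v w => f (g v :: w)) (u ++ (c • a) :: w) =
        c • splitSum (fun v w => f (g v :: w)) (u ++ a :: w) := fun hf =>
      splitSum_map_smul _ c (fun v u a w => by rw [hg.map_smul]; exact hf.map_smul [] _ _ _)
        (fun v u a w => (hf.cons (g v)).map_smul u c a w)
    induction u generalizing f with
    | nil =>
      have h := key hf [] a w
      simp only [List.nil_append] at h ⊢
      rw [ins_cons, ins_cons, h,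
        show (fun l => f ((c • a) :: l)) = fun l => c • f (a :: l) from
          funext fun l => hf.map_smul [] c a l, ins_smul, smul_add, mul_smul_comm]
    | cons d u ih =>
      have h := key hf (d :: u) a w
      simp only [List.cons_append] at h ⊢
      rw [ins_cons, ins_cons, h, ih (hf.cons d), smul_add, mul_smul_comm]

theorem ins_eq_zero {ε : A} {m n : ℕ} {f g : List A → A} (hf : IsAdd f) (hm : ∀ l, l.length ≠ m → f l = 0)
    (hn : ∀ l, l.length ≠ n → g l = 0) (l : List A) (hl : l.length + 1 ≠ m + n) :
    ins ε g f l = 0 := by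
  induction l generalizing f m with
  | nil =>
    rw [ins_nil]
    by_cases h : n = 0
    · exact hm _ (by simp at hl ⊢; omega)
    · rw [hn [] (fun h' => h h'.symm), hf.zero_head]
  | cons a l ih =>
    rw [ins_cons, splitSum_congr (G' := fun _ _ => 0), splitSum_zero]
    · cases m with
      | zero =>
        rw [show (fun l => f (a :: l)) = fun _ => 0 from funext fun l => hm _ (by simp), ins_zero]
        simp
      | succ m =>
        rw [ih (hf.cons a) (m := m) (fun l hl => hm _ (by simpa using hl))
          (by simp at hl; omega)]
        simp
    · intro v w h
      have hlen := congrArg List.length h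
      simp only [List.length_append, List.length_cons] at hlen hl
      by_cases hv : v.length = n
      · exact hm _ (by simp; omega)
      · rw [hn v hv, hf.zero_head]

end Words2

noncomputable section Cochains

variable (k A : Type*) [Field k] [CommRing A] [Algebra k A]

/-- The Hochschild `n`-cochains `Hom(A^{⊗ n}, A)`. A cochain is written as a function on words
`[a₁, …, aₙ]` in `A` that is `k`-linear in every letter and is extended by zero to the words of
length different from `n`. They are zero for `n < 0`. -/
def hochschildCochains (n : ℤ) : Submodule k (List A → A) where
  carrier := {f | IsMultilinear k f ∧ ∀ l : List A, (l.length : ℤ) ≠ n → f l = 0}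
  add_mem' := by
    rintro f g ⟨hf, hf'⟩ ⟨hg, hg'⟩
    refine ⟨⟨fun u a b w => ?_, fun u c a w => ?_⟩, fun l hl => ?_⟩
    · simp only [Pi.add_apply, hf.map_add, hg.map_add]; ring
    · simp only [Pi.add_apply, hf.map_smul, hg.map_smul, smul_add]
    · simp [hf' l hl, hg' l hl]
  zero_mem' := ⟨⟨by simp, by simp⟩, by simp⟩
  smul_mem' := by
    rintro c f ⟨hf, hf'⟩
    refine ⟨⟨fun u a b w => ?_, fun u d a w => ?_⟩, fun l hl => ?_⟩
    · simp only [Pi.smul_apply, hf.map_add, smul_add]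
    · simp only [Pi.smul_apply, hf.map_smul, smul_comm c]
    · simp [hf' l hl]

theorem onShuffle_smul {A : Type*} [CommRing A] [Algebra k A] (c : k) (f : List A → A)
    (x y : List A) : onShuffle (fun l => c • f l) x y = c • onShuffle f x y := by
  simp only [Algebra.smul_def]
  exact onShuffle_mul (algebraMap k A c) f x y

/-- The Harrison `n`-cochains: the Hochschild cochains vanishing on all shuffle products of two
words of positive length. -/
def harrisonCochains (n : ℤ) : Submodule k (List A → A) where
  carrier := {f | f ∈ hochschildCochains k A n ∧
    ∀ x y : List A, x ≠ [] → y ≠ [] → onShuffle f x y = 0}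
  add_mem' := by
    rintro f g ⟨hf, hf'⟩ ⟨hg, hg'⟩
    refine ⟨add_mem hf hg, fun x y hx hy => ?_⟩
    have := onShuffle_add f g x y
    rw [hf' x y hx hy, hg' x y hx hy, add_zero] at this
    exact this
  zero_mem' := ⟨zero_mem _, fun x y _ _ => onShuffle_zero x y⟩
  smul_mem' := by
    rintro c f ⟨hf, hf'⟩
    refine ⟨Submodule.smul_mem _ _ hf, fun x y hx hy => ?_⟩
    have := onShuffle_smul k c f x y
    rw [hf' x y hx hy, smul_zero] at this
    exact this

variable {k A}

/-- The Gerstenhaber bracket `[f, g]_G = f ∘ g - (-1)^{(m - 1)(n - 1)} g ∘ f` of cochains of degrees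
`m` and `n`. -/
def gerstenhaberBracket (m n : ℤ) (f g : List A → A) : List A → A :=
  circ f g - ((m - 1) * (n - 1)).negOnePow • circ g f

/-- The sign `(-1)^n` in the ring `A`. -/
def sgn (A : Type*) [CommRing A] (n : ℤ) : A := ((n.negOnePow : ℤ) : A)

theorem sgn_eq (n : ℤ) (N : ℕ) (h : Even (n - N)) : sgn A n = (-1) ^ N := by
  rw [sgn, (Int.negOnePow_eq_iff n N).2 h]
  exact Int.cast_negOnePow_natCast A N

theorem sgn_mul_self (n : ℤ) : sgn A n * sgn A n = 1 := by
  rw [sgn, ← Int.cast_mul, ← Units.val_mul, Int.units_mul_self]; simp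

theorem sgn_add (m n : ℤ) : sgn A (m + n) = sgn A m * sgn A n := by
  rw [sgn, sgn, sgn, Int.negOnePow_add, Units.val_mul, Int.cast_mul]

theorem even_sub_natAbs (n : ℤ) : Even (n - 1) ↔ Even ((n.natAbs + 1 : ℕ) : ℤ) := by
  rw [Int.even_iff, Int.even_iff, Nat.cast_add, Nat.cast_one]; omega

theorem sgn_sub_one (n : ℤ) : sgn A (n - 1) = (-1) ^ (n.natAbs + 1) :=
  sgn_eq _ _ (Int.even_sub.2 (even_sub_natAbs n))

theorem sgn_mul (m n : ℤ) :
    sgn A ((m - 1) * (n - 1)) = (-1) ^ ((m.natAbs + 1) * (n.natAbs + 1)) :=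
  sgn_eq _ _ (Int.even_sub.2 (by
    rw [Nat.cast_mul, Int.even_mul, Int.even_mul, even_sub_natAbs, even_sub_natAbs]))

theorem homog_of_mem {n : ℤ} {f : List A → A} (hf : f ∈ hochschildCochains k A n) :
    Homog (sgn A (n - 1)) n.natAbs f where
  supp l hl := hf.2 l (by omega)
  sign := sgn_sub_one n

theorem circ_eq {m n : ℤ} {f g : List A → A} (hf : f ∈ hochschildCochains k A m)
    (hg : g ∈ hochschildCochains k A n) : circ f g = ins (sgn A (n - 1)) g f :=
  funext fun l => circ_eq_ins hf.1.isAdd (homog_of_mem hg) l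

theorem gerstenhaberBracket_eq {m n : ℤ} {f g : List A → A} (hf : f ∈ hochschildCochains k A m)
    (hg : g ∈ hochschildCochains k A n) : gerstenhaberBracket m n f g =
      fun l => ins (sgn A (n - 1)) g f l -
        sgn A ((m - 1) * (n - 1)) * ins (sgn A (m - 1)) f g l := by
  funext l
  rw [gerstenhaberBracket, circ_eq hf hg, circ_eq hg hf, Pi.sub_apply, Units.smul_def,
    Pi.smul_apply, zsmul_eq_mul]
  rfl

theorem circ_mem_hochschildCochains {m n l : ℤ} (h : m + n = l + 1) {f g : List A → A}
    (hf : f ∈ hochschildCochains k A m) (hg : g ∈ hochschildCochains k A n) :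
    circ f g ∈ hochschildCochains k A l := by
  rw [circ_eq hf hg]
  refine ⟨isMultilinear_ins _ hf.1 hg.1, fun x hx => ?_⟩
  by_cases hm : 0 ≤ m
  · by_cases hn : 0 ≤ n
    · exact ins_eq_zero hf.1.isAdd (m := m.toNat) (n := n.toNat) (fun l hl => hf.2 l (by omega))
        (fun l hl => hg.2 l (by omega)) x (by omega)
    · have hg0 : g = fun _ => 0 := funext fun l => hg.2 l (by omega)
      exact ins_eq_zero hf.1.isAdd (m := m.toNat) (n := x.length + 2) (fun l hl => hf.2 l (by omega))
        (fun l hl => by rw [hg0]) x (by omega)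
  · have hf0 : f = fun _ => 0 := funext fun l => hf.2 l (by omega)
    rw [hf0, ins_zero]

theorem circ_mem_harrisonCochains {m n l : ℤ} (h : m + n = l + 1) {f g : List A → A}
    (hf : f ∈ harrisonCochains k A m) (hg : g ∈ harrisonCochains k A n) :
    circ f g ∈ harrisonCochains k A l := by
  refine ⟨circ_mem_hochschildCochains h hf.1 hg.1, ?_⟩
  rw [circ_eq hf.1 hg.1]
  exact onShuffle_ins_eq_zero (homog_of_mem hg.1) hf.1.1.isAdd hf.2 hg.2

theorem gerstenhaberBracket_mem {m n l : ℤ} (h : m + n = l + 1) {f g : List A → A}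
    (hf : f ∈ harrisonCochains k A m) (hg : g ∈ harrisonCochains k A n) :
    gerstenhaberBracket m n f g ∈ harrisonCochains k A l := by
  refine Submodule.sub_mem _ (circ_mem_harrisonCochains h hf hg) ?_
  rw [Units.smul_def]
  exact zsmul_mem (circ_mem_harrisonCochains (by omega) hg hf) _

theorem ins_sub (ε : A) (g F F' : List A → A) (c : A) (l : List A) :
    ins ε g (fun l => F l - c * F' l) l = ins ε g F l - c * ins ε g F' l := by
  have := ins_add ε g F (fun l => (-c) * F' l) l
  rw [ins_mul] at this
  rw [show (fun l => F l - c * F' l) = fun l => F l + (-c) * F' l by funext l; ring, this]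
  ring

theorem ins_bracket {a b c d : ℤ} {f g h : List A → A} (hf : f ∈ hochschildCochains k A a)
    (hg : g ∈ hochschildCochains k A b) (hh : h ∈ hochschildCochains k A c)
    (hd : d = b + c - 1) (l : List A) :
    ins (sgn A (d - 1)) (gerstenhaberBracket b c g h) f l =
      ins (sgn A (c - 1)) h (ins (sgn A (b - 1)) g f) l -
        sgn A ((b - 1) * (c - 1)) * ins (sgn A (b - 1)) g (ins (sgn A (c - 1)) h f) l := by
  rw [gerstenhaberBracket_eq hg hh, ins_comm hf.1.isAdd (homog_of_mem hg) (homog_of_mem hh) _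
    (sgn_mul b c), show d - 1 = (b - 1) + (c - 1) by omega, sgn_add]

/-- The graded Jacobi identity for the Gerstenhaber bracket. -/
theorem jacobi {a b c d e p : ℤ} {f g h : List A → A} (hf : f ∈ harrisonCochains k A a)
    (hg : g ∈ harrisonCochains k A b) (hh : h ∈ harrisonCochains k A c)
    (hd : b + c = d + 1) (he : a + b = e + 1) (hp : a + c = p + 1) :
    gerstenhaberBracket a d f (gerstenhaberBracket b c g h) =
      gerstenhaberBracket e c (gerstenhaberBracket a b f g) h +
      ((a - 1) * (b - 1)).negOnePow •
        gerstenhaberBracket b p g (gerstenhaberBracket a c f h) := by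
  have hgh := gerstenhaberBracket_mem hd hg hh
  have hfg := gerstenhaberBracket_mem he hf hg
  have hfh := gerstenhaberBracket_mem hp hf hh
  funext l
  rw [gerstenhaberBracket_eq hf.1 hgh.1, gerstenhaberBracket_eq hfg.1 hh.1,
    gerstenhaberBracket_eq hg.1 hfh.1]
  rw [Pi.add_apply, Pi.smul_apply, Units.smul_def, zsmul_eq_mul]
  change _ = _ + sgn A _ * _
  simp only [ins_bracket hf.1 hg.1 hh.1 (d := d) (by omega),
    ins_bracket hh.1 hf.1 hg.1 (d := e) (by omega), ins_bracket hg.1 hf.1 hh.1 (d := p) (by omega)]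
  rw [gerstenhaberBracket_eq hg.1 hh.1, gerstenhaberBracket_eq hf.1 hg.1,
    gerstenhaberBracket_eq hf.1 hh.1]
  simp only [ins_sub]
  have e1 : sgn A ((a - 1) * (d - 1)) = sgn A ((a - 1) * (b - 1)) * sgn A ((a - 1) * (c - 1)) := by
    rw [← sgn_add]; congr 1; rw [show d = b + c - 1 by omega]; ring
  have e2 : sgn A ((e - 1) * (c - 1)) = sgn A ((a - 1) * (c - 1)) * sgn A ((b - 1) * (c - 1)) := by
    rw [← sgn_add]; congr 1; rw [show e = a + b - 1 by omega]; ring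
  have e3 : sgn A ((b - 1) * (p - 1)) = sgn A ((a - 1) * (b - 1)) * sgn A ((b - 1) * (c - 1)) := by
    rw [← sgn_add]; congr 1; rw [show p = a + c - 1 by omega]; ring
  have k1 := sgn_mul_self (A := A) ((a - 1) * (b - 1))
  have k2 := sgn_mul_self (A := A) ((b - 1) * (c - 1))
  have k3 := sgn_mul_self (A := A) ((a - 1) * (c - 1))
  rw [e1, e2, e3]
  generalize sgn A ((a - 1) * (b - 1)) = x at *
  generalize sgn A ((b - 1) * (c - 1)) = y at *
  generalize sgn A ((a - 1) * (c - 1)) = z at *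
  have k1' : x ^ 2 = 1 := by rw [sq, k1]
  ring_nf
  simp only [k1']
  ring

end Cochains

noncomputable section GradedSym

variable (k : Type*) [Field k] (V : ℤ → Type*) [∀ i, AddCommGroup (V i)] [∀ i, Module k (V i)]

/-- The relations `x ⊗ y = (-1)^{|x||y|} y ⊗ x`, for homogeneous `x`, `y`, in the tensor algebra. -/
inductive GradedSymRel :
    TensorAlgebra k (⨁ i, V i) → TensorAlgebra k (⨁ i, V i) → Prop
  | comm (i j : ℤ) (x : V i) (y : V j) : GradedSymRel
      (TensorAlgebra.ι k (DirectSum.lof k ℤ V i x) * TensorAlgebra.ι k (DirectSum.lof k ℤ V j y))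
      ((i * j).negOnePow •
        (TensorAlgebra.ι k (DirectSum.lof k ℤ V j y) * TensorAlgebra.ι k (DirectSum.lof k ℤ V i x)))

/-- The graded symmetric algebra `Sym V` of the graded vector space `V`. -/
def GradedSym : Type _ := RingQuot (GradedSymRel k V)

namespace GradedSym

instance : Ring (GradedSym k V) := inferInstanceAs (Ring (RingQuot (GradedSymRel k V)))

instance : Algebra k (GradedSym k V) := inferInstanceAs (Algebra k (RingQuot (GradedSymRel k V)))

/-- The inclusion of the generators `V → Sym V`. -/
def ι : (⨁ i, V i) →ₗ[k] GradedSym k V :=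
  (RingQuot.mkAlgHom k (GradedSymRel k V)).toLinearMap ∘ₗ TensorAlgebra.ι k

theorem ι_comm (i j : ℤ) (x : V i) (y : V j) :
    ι k V (DirectSum.lof k ℤ V i x) * ι k V (DirectSum.lof k ℤ V j y) =
      (i * j).negOnePow •
        (ι k V (DirectSum.lof k ℤ V j y) * ι k V (DirectSum.lof k ℤ V i x)) := by
  have := RingQuot.mkAlgHom_rel k (GradedSymRel.comm (k := k) (V := V) i j x y)
  rw [Units.smul_def, map_zsmul, map_mul, map_mul] at this
  exact this

variable {k V} in
/-- The universal property of `Sym V`: algebra morphisms out of it. -/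
def lift {B : Type*} [Ring B] [Algebra k B] (f : (⨁ i, V i) →ₗ[k] B)
    (hf : ∀ i j (x : V i) (y : V j), f (DirectSum.lof k ℤ V i x) * f (DirectSum.lof k ℤ V j y) =
      (i * j).negOnePow • (f (DirectSum.lof k ℤ V j y) * f (DirectSum.lof k ℤ V i x))) :
    GradedSym k V →ₐ[k] B :=
  RingQuot.liftAlgHom k ⟨TensorAlgebra.lift k f, by
    rintro _ _ ⟨i, j, x, y⟩
    rw [Units.smul_def, map_zsmul]
    simpa [Units.smul_def] using hf i j x y⟩

theorem lift_ι {B : Type*} [Ring B] [Algebra k B] (f : (⨁ i, V i) →ₗ[k] B)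
    (hf : ∀ i j (x : V i) (y : V j), f (DirectSum.lof k ℤ V i x) * f (DirectSum.lof k ℤ V j y) =
      (i * j).negOnePow • (f (DirectSum.lof k ℤ V j y) * f (DirectSum.lof k ℤ V i x)))
    (v : ⨁ i, V i) : lift f hf (ι k V v) = f v := by
  have : lift f hf (RingQuot.mkAlgHom k (GradedSymRel k V) (TensorAlgebra.ι k v)) = _ :=
    RingQuot.liftAlgHom_mkAlgHom_apply k _ _ _
  exact this.trans (TensorAlgebra.lift_ι_apply f v)

variable {k V} in
theorem algHom_ext {B : Type*} [Ring B] [Algebra k B] {f g : GradedSym k V →ₐ[k] B}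
    (h : ∀ i (x : V i), f (ι k V (DirectSum.lof k ℤ V i x)) =
      g (ι k V (DirectSum.lof k ℤ V i x))) : f = g := by
  refine RingQuot.ringQuot_ext' (s := GradedSymRel k V) k f g ?_
  ext i x
  exact h i x

/-- The product `v₁ ⋯ vₙ ∈ Sym V` of a list of homogeneous elements of `V`. -/
def monomial (l : List (Σ i, V i)) : GradedSym k V :=
  (l.map fun p => ι k V (DirectSum.lof k ℤ V p.1 p.2)).prod

/-- The grading of `Sym V`: the part of degree `n` is spanned by the products `v₁ ⋯ vₘ` with
`|v₁| + ⋯ + |vₘ| = n`. -/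
def grading (n : ℤ) : Submodule k (GradedSym k V) :=
  Submodule.span k {x | ∃ l : List (Σ i, V i), (l.map Sigma.fst).sum = n ∧ x = monomial k V l}

theorem monomial_mem (l : List (Σ i, V i)) :
    monomial k V l ∈ grading k V (l.map Sigma.fst).sum :=
  Submodule.subset_span ⟨l, rfl, rfl⟩

theorem ι_mem (i : ℤ) (x : V i) : ι k V (DirectSum.lof k ℤ V i x) ∈ grading k V i := by
  have := monomial_mem k V [⟨i, x⟩]
  simpa [monomial] using this

instance : SetLike.GradedMonoid (grading k V) where
  one_mem := Submodule.subset_span ⟨[], rfl, rfl⟩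
  mul_mem i j x y hx hy := by
    have : x * y ∈ grading k V i * grading k V j := Submodule.mul_mem_mul hx hy
    rw [grading, grading, Submodule.span_mul_span] at this
    refine Submodule.span_mono ?_ this
    rintro _ ⟨_, ⟨l, hl, rfl⟩, _, ⟨l', hl', rfl⟩, rfl⟩
    exact ⟨l ++ l', by simp [hl, hl'], by simp [monomial]⟩

theorem of_eq {i j : ℤ} (h : i = j) (x : grading k V i) (y : grading k V j)
    (hxy : (x : GradedSym k V) = y) :
    DirectSum.of (fun i => grading k V i) i x = DirectSum.of (fun i => grading k V i) j y := by
  subst h; rw [Subtype.ext hxy]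

def decomposeGen : (⨁ i, V i) →ₗ[k] ⨁ i, grading k V i :=
  DirectSum.toModule k ℤ _ fun i => DirectSum.lof k ℤ (fun i => grading k V i) i ∘ₗ
    ((ι k V ∘ₗ DirectSum.lof k ℤ V i).codRestrict _ fun x => ι_mem k V i x)

theorem decomposeGen_lof (i : ℤ) (x : V i) : decomposeGen k V (DirectSum.lof k ℤ V i x) =
    DirectSum.of (fun i => grading k V i) i ⟨_, ι_mem k V i x⟩ := by
  rw [decomposeGen, DirectSum.toModule_lof]; rfl

/-- The decomposition of `Sym V` into its homogeneous parts. -/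
def decomposeHom : GradedSym k V →ₐ[k] ⨁ i, grading k V i :=
  lift (V := V) (B := ⨁ i, grading k V i) (decomposeGen k V) (by
    intro i j x y
    rw [decomposeGen_lof, decomposeGen_lof, DirectSum.of_mul_of, DirectSum.of_mul_of,
      Units.smul_def]
    refine Eq.trans ?_ (map_zsmul (DirectSum.of (fun i => grading k V i) (j + i)) _ _)
    exact of_eq k V (add_comm i j) _ _ (ι_comm k V i j x y))

theorem decomposeHom_ι (i : ℤ) (x : V i) : decomposeHom k V (ι k V (DirectSum.lof k ℤ V i x)) =
    DirectSum.of (fun i => grading k V i) i ⟨_, ι_mem k V i x⟩ := by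
  rw [decomposeHom, lift_ι, decomposeGen_lof]

instance : GradedAlgebra (grading k V) :=
  GradedAlgebra.ofAlgHom _ (decomposeHom k V)
    (by
      refine algHom_ext fun i x => ?_
      rw [AlgHom.comp_apply, decomposeHom_ι, DirectSum.coeAlgHom_of]
      rfl)
    (by
      have key : ∀ l : List (Σ i, V i), decomposeHom k V (monomial k V l) =
          DirectSum.of (fun i => grading k V i) _ ⟨_, monomial_mem k V l⟩ := by
        intro l
        induction l with
        | nil => exact map_one _
        | cons p l ih =>
          have : monomial k V (p :: l) = ι k V (DirectSum.lof k ℤ V p.1 p.2) * monomial k V l := by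
            simp [monomial]
          have h2 : decomposeHom k V (monomial k V (p :: l)) =
              decomposeHom k V (ι k V (DirectSum.lof k ℤ V p.1 p.2) * monomial k V l) := by rw [this]
          rw [h2, map_mul, ih, decomposeHom_ι, DirectSum.of_mul_of]
          exact of_eq k V (by simp) _ _ this.symm
      rintro i ⟨x, hx⟩
      induction hx using Submodule.span_induction with
      | mem x h =>
        obtain ⟨l, rfl, rfl⟩ := h
        exact key l
      | zero => rw [map_zero]; exact (map_zero _).symm
      | add x y hx hy ihx ihy =>
        simp only at ihx ihy ⊢
        rw [map_add, ihx, ihy, ← map_add]; rfl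
      | smul c x hx ih =>
        simp only at ih ⊢
        rw [map_smul, ih, ← DirectSum.lof_eq_of k, ← map_smul]; rfl)

/-- The comultiplication of `Sym V`: the morphism of graded algebras `Sym V → Sym V ⊗ Sym V`
(with the Koszul sign rule on the target) sending `v ∈ V` to `v ⊗ 1 + 1 ⊗ v`. -/
def comulHom : GradedSym k V →ₐ[k] GradedTensorProduct k (grading k V) (grading k V) :=
  lift (V := V) ((GradedTensorProduct.includeLeft (grading k V) (grading k V)).toLinearMap ∘ₗ ι k V +
      (GradedTensorProduct.includeRight (grading k V) (grading k V)).toLinearMap ∘ₗ ι k V) (by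
    intro i j x y
    have hxy := ι_comm k V i j x y
    let a : grading k V i := ⟨_, ι_mem k V i x⟩
    let b : grading k V j := ⟨_, ι_mem k V j y⟩
    have hab : (a : GradedSym k V) * b = (i * j).negOnePow • ((b : GradedSym k V) * a) := hxy
    have h1 := GradedTensorProduct.tmul_coe_mul_coe_tmul (R := k) (grading k V) (grading k V)
      (1 : GradedSym k V) a b (1 : GradedSym k V)
    have h2 := GradedTensorProduct.tmul_coe_mul_coe_tmul (R := k) (grading k V) (grading k V)
      (1 : GradedSym k V) b a (1 : GradedSym k V)
    have h3 := GradedTensorProduct.tmul_one_mul_one_tmul (R := k) (grading k V) (grading k V)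
      (a : GradedSym k V) (b : GradedSym k V)
    have h4 := GradedTensorProduct.tmul_one_mul_one_tmul (R := k) (grading k V) (grading k V)
      (b : GradedSym k V) (a : GradedSym k V)
    simp only [one_mul, mul_one] at h1 h2
    have hl := congrArg (GradedTensorProduct.includeLeft (grading k V) (grading k V)) hab
    have hr := congrArg (GradedTensorProduct.includeRight (grading k V) (grading k V)) hab
    rw [Units.smul_def, map_zsmul, map_mul, map_mul] at hl hr
    have hs : (((i * j).negOnePow : ℤˣ) : ℤ) * ((i * j).negOnePow : ℤˣ) = 1 := by
      rw [← Units.val_mul, Int.units_mul_self, Units.val_one]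
    have e1 : ((-1 : ℤˣ) ^ (i * j) : ℤˣ) = (i * j).negOnePow := rfl
    have e2 : ((-1 : ℤˣ) ^ (j * i) : ℤˣ) = (i * j).negOnePow := by rw [mul_comm]; rfl
    rw [e1, Units.smul_def] at h1
    rw [e2, Units.smul_def] at h2
    change ((GradedTensorProduct.includeLeft (grading k V) (grading k V)) (a : GradedSym k V) +
      (GradedTensorProduct.includeRight (grading k V) (grading k V)) (a : GradedSym k V)) *
      ((GradedTensorProduct.includeLeft (grading k V) (grading k V)) (b : GradedSym k V) +
      (GradedTensorProduct.includeRight (grading k V) (grading k V)) (b : GradedSym k V)) =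
      (i * j).negOnePow •
      (((GradedTensorProduct.includeLeft (grading k V) (grading k V)) (b : GradedSym k V) +
      (GradedTensorProduct.includeRight (grading k V) (grading k V)) (b : GradedSym k V)) *
      ((GradedTensorProduct.includeLeft (grading k V) (grading k V)) (a : GradedSym k V) +
      (GradedTensorProduct.includeRight (grading k V) (grading k V)) (a : GradedSym k V)))
    have h1' : (GradedTensorProduct.includeRight (grading k V) (grading k V)) (a : GradedSym k V) *
      (GradedTensorProduct.includeLeft (grading k V) (grading k V)) (b : GradedSym k V) =
      ((i * j).negOnePow : ℤ) • GradedTensorProduct.tmul k (b : GradedSym k V) (a : GradedSym k V) := h1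
    have h2' : (GradedTensorProduct.includeRight (grading k V) (grading k V)) (b : GradedSym k V) *
      (GradedTensorProduct.includeLeft (grading k V) (grading k V)) (a : GradedSym k V) =
      ((i * j).negOnePow : ℤ) • GradedTensorProduct.tmul k (a : GradedSym k V) (b : GradedSym k V) := h2
    have h3' : (GradedTensorProduct.includeLeft (grading k V) (grading k V)) (a : GradedSym k V) *
      (GradedTensorProduct.includeRight (grading k V) (grading k V)) (b : GradedSym k V) =
      GradedTensorProduct.tmul k (a : GradedSym k V) (b : GradedSym k V) := h3
    have h4' : (GradedTensorProduct.includeLeft (grading k V) (grading k V)) (b : GradedSym k V) *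
      (GradedTensorProduct.includeRight (grading k V) (grading k V)) (a : GradedSym k V) =
      GradedTensorProduct.tmul k (b : GradedSym k V) (a : GradedSym k V) := h4
    rw [Units.smul_def]
    simp only [add_mul, mul_add, smul_add, h1', h2', h3', h4', hl, hr, smul_smul, hs, one_smul]
    abel)

/-- The comultiplication `Δ : Sym V → Sym V ⊗ Sym V`, as a linear map. -/
def comul : GradedSym k V →ₗ[k] GradedSym k V ⊗[k] GradedSym k V :=
  ((GradedTensorProduct.of k (grading k V) (grading k V)).symm : _ →ₗ[k] _) ∘ₗ
    (comulHom k V).toLinearMap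

/-- The counit `ε : Sym V → k`, sending `V` to zero. -/
def counit : GradedSym k V →ₐ[k] k :=
  lift (V := V) (0 : (⨁ i, V i) →ₗ[k] k) (by intro i j x y; simp)

variable {V}

/-- For a bilinear map `D` on `V`, the operator
`v ↦ ((c, x, w) ↦ (0, c • v, D v x))` on `k × V × V`. -/
def truncationGen (D : (⨁ i, V i) →ₗ[k] (⨁ i, V i) →ₗ[k] ⨁ i, V i) :
    (⨁ i, V i) →ₗ[k] Module.End k (k × (⨁ i, V i) × ⨁ i, V i) where
  toFun v := LinearMap.prod 0 (LinearMap.prod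
    ((LinearMap.toSpanSingleton k _ v) ∘ₗ LinearMap.fst k k _)
    (D v ∘ₗ LinearMap.fst k _ _ ∘ₗ LinearMap.snd k k _))
  map_add' v v' := by
    refine LinearMap.ext fun ⟨c, x, w⟩ => ?_
    simp
  map_smul' r v := by
    refine LinearMap.ext fun ⟨c, x, w⟩ => ?_
    simp [smul_comm c r v]

/-- A bilinear map on the graded vector space `V` is graded symmetric. -/
def IsGradedSymmetric (D : (⨁ i, V i) →ₗ[k] (⨁ i, V i) →ₗ[k] ⨁ i, V i) : Prop :=
  ∀ i j (x : V i) (y : V j), D (DirectSum.lof k ℤ V i x) (DirectSum.lof k ℤ V j y) =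
    (i * j).negOnePow • D (DirectSum.lof k ℤ V j y) (DirectSum.lof k ℤ V i x)

/-- For a graded symmetric bilinear map `D` on `V`, the linear map `Sym V → k × V × V` whose
components are the counit, the projection to `V = Sym¹ V`, and the projection to `Sym² V` followed
by `D`; it sends `1`, `v`, `v₁ v₂` and `v₁ ⋯ vₙ` for `n ≥ 3` to `(1, 0, 0)`, `(0, v, 0)`,
`(0, 0, D v₁ v₂)` and `0`. -/
def truncation (D : (⨁ i, V i) →ₗ[k] (⨁ i, V i) →ₗ[k] ⨁ i, V i) (hD : IsGradedSymmetric k D) :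
    GradedSym k V →ₗ[k] k × (⨁ i, V i) × ⨁ i, V i :=
  LinearMap.applyₗ (1, 0, 0) ∘ₗ (lift (truncationGen k D) (by
    intro i j x y
    refine LinearMap.ext fun ⟨c, z, w⟩ => ?_
    have h := hD i j x y
    generalize (i * j).negOnePow = u at h
    rw [Units.smul_def] at h ⊢
    refine Prod.ext ?_ (Prod.ext ?_ ?_)
    · simp [truncationGen]
    · simp [truncationGen]
    · simp [truncationGen, h, smul_comm c])).toLinearMap

variable (V) in
theorem isGradedSymmetric_zero :
    IsGradedSymmetric k (0 : (⨁ i, V i) →ₗ[k] (⨁ i, V i) →ₗ[k] ⨁ i, V i) := by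
  intro i j x y; simp

variable (V) in
/-- The projection `Sym V → V` to the component `V = Sym¹ V`. -/
def proj : GradedSym k V →ₗ[k] ⨁ i, V i :=
  LinearMap.fst k _ _ ∘ₗ LinearMap.snd k k _ ∘ₗ truncation k 0 (isGradedSymmetric_zero k V)

/-- The linear map `Sym V → V` equal to `b` on `V = Sym¹ V`, to `D` on `Sym² V` and to zero on the
other components. -/
def corestriction (b : (⨁ i, V i) →ₗ[k] ⨁ i, V i)
    (D : (⨁ i, V i) →ₗ[k] (⨁ i, V i) →ₗ[k] ⨁ i, V i) (hD : IsGradedSymmetric k D) :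
    GradedSym k V →ₗ[k] ⨁ i, V i :=
  b ∘ₗ proj k V + LinearMap.snd k _ _ ∘ₗ LinearMap.snd k k _ ∘ₗ truncation k D hD

/-- The coderivation of `Sym V` with corestriction `q : Sym V → V`. It is the convolution product
of `q` with the identity: `x ↦ ∑ q(x') x''` where `Δ x = ∑ x' ⊗ x''`. -/
def coderivation (q : GradedSym k V →ₗ[k] ⨁ i, V i) : GradedSym k V →ₗ[k] GradedSym k V :=
  LinearMap.mul' k (GradedSym k V) ∘ₗ TensorProduct.map (ι k V ∘ₗ q) LinearMap.id ∘ₗ comul k V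

theorem corestriction_one (b : (⨁ i, V i) →ₗ[k] ⨁ i, V i)
    (D : (⨁ i, V i) →ₗ[k] (⨁ i, V i) →ₗ[k] ⨁ i, V i) (hD : IsGradedSymmetric k D) :
    corestriction k b D hD 1 = 0 := by
  simp [corestriction, proj, truncation]

theorem corestriction_ι (b : (⨁ i, V i) →ₗ[k] ⨁ i, V i)
    (D : (⨁ i, V i) →ₗ[k] (⨁ i, V i) →ₗ[k] ⨁ i, V i) (hD : IsGradedSymmetric k D) (v) :
    corestriction k b D hD (ι k V v) = b v := by
  simp [corestriction, proj, truncation, lift_ι, truncationGen]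

theorem corestriction_ι_mul_ι (b : (⨁ i, V i) →ₗ[k] ⨁ i, V i)
    (D : (⨁ i, V i) →ₗ[k] (⨁ i, V i) →ₗ[k] ⨁ i, V i) (hD : IsGradedSymmetric k D) (v w) :
    corestriction k b D hD (ι k V v * ι k V w) = D v w := by
  simp [corestriction, proj, truncation, lift_ι, truncationGen]

theorem corestriction_ι_mul_ι_mul_ι_mul (b : (⨁ i, V i) →ₗ[k] ⨁ i, V i)
    (D : (⨁ i, V i) →ₗ[k] (⨁ i, V i) →ₗ[k] ⨁ i, V i) (hD : IsGradedSymmetric k D) (u v w x) :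
    corestriction k b D hD (ι k V u * (ι k V v * (ι k V w * x))) = 0 := by
  simp [corestriction, proj, truncation, lift_ι, truncationGen]

end GradedSym
end GradedSym
noncomputable section Cohomology

variable (k A : Type*) [Field k] [CommRing A] [Algebra k A]

/-- The product `μ₀` of `A` as a 2-cochain. -/
def mulCochain (A : Type*) [CommRing A] : List A → A
  | [a, b] => a * b
  | _ => 0

theorem mulCochain_mem : mulCochain A ∈ harrisonCochains k A 2 := by
  have h0 : ∀ l : List A, l.length ≠ 2 → mulCochain A l = 0 := by
    intro l hl
    match l with
    | [] => rfl
    | [_] => rfl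
    | [_, _] => exact absurd rfl hl
    | _ :: _ :: _ :: _ => rfl
  refine ⟨⟨⟨fun u a b w => ?_, fun u c a w => ?_⟩, fun l hl => h0 l (by omega)⟩,
    fun x y hx hy => ?_⟩
  · match u, w with
    | [], [] => simp [mulCochain]
    | [], [d] => simp [mulCochain, add_mul]
    | [d], [] => simp [mulCochain, mul_add]
    | [], _ :: _ :: _ => simp [mulCochain]
    | [_], _ :: _ => simp [mulCochain]
    | _ :: _ :: u, _ => rw [h0, h0, h0, add_zero] <;> simp
  · match u, w with
    | [], [] => simp [mulCochain]
    | [], [d] => simp [mulCochain]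
    | [d], [] => simp [mulCochain]
    | [], _ :: _ :: _ => simp [mulCochain]
    | [_], _ :: _ => simp [mulCochain]
    | _ :: _ :: u, _ => rw [h0, h0, smul_zero] <;> simp
  · match x, y with
    | [a], [b] =>
      rw [onShuffle_cons, onShuffle_nil_left, onShuffle_nil_right]
      simp [mulCochain, mul_comm]
    | _ :: _ :: _, [] => exact absurd rfl hy
    | [], _ => exact absurd rfl hx
    | [_], [] => exact absurd rfl hy
    | [_], _ :: _ :: _ =>
      rw [onShuffle_congr (f' := fun _ => 0), onShuffle_zero]
      intro l hl; exact h0 l (by simp at hl; omega)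
    | _ :: _ :: _, _ :: _ =>
      rw [onShuffle_congr (f' := fun _ => 0), onShuffle_zero]
      intro l hl; exact h0 l (by simp at hl; omega)

instance (n : ℤ) : AddCommGroup (harrisonCochains k A n) := Submodule.addCommGroup _

variable {k A}

theorem circ_add_left (f f' g : List A → A) : circ (f + f') g = circ f g + circ f' g := by
  funext l
  simp only [circ, Pi.add_apply, mul_add, Finset.sum_add_distrib]

theorem circ_smul_left (c : k) (f g : List A → A) : circ (c • f) g = c • circ f g := by
  funext l
  simp only [circ, Pi.smul_apply, mul_smul_comm, Finset.smul_sum]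

theorem circ_add_right {f : List A → A} (hf : IsMultilinear k f) (g g' : List A → A) :
    circ f (g + g') = circ f g + circ f g' := by
  funext l
  simp only [circ, Pi.add_apply, hf.map_add, mul_add, Finset.sum_add_distrib]

theorem circ_smul_right (c : k) {f : List A → A} (hf : IsMultilinear k f) (g : List A → A) :
    circ f (c • g) = c • circ f g := by
  funext l
  simp only [circ, Pi.smul_apply, hf.map_smul, mul_smul_comm, Finset.smul_sum]

/-- The Gerstenhaber bracket as a bilinear map on Harrison cochains. -/
def cochainBracket {i j l : ℤ} (h : i + j = l + 1) :
    harrisonCochains k A i →ₗ[k] harrisonCochains k A j →ₗ[k] harrisonCochains k A l :=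
  LinearMap.mk₂ k (fun f g => ⟨gerstenhaberBracket i j f g, gerstenhaberBracket_mem h f.2 g.2⟩)
    (fun f f' g => Subtype.ext (by
      simp only [gerstenhaberBracket, Submodule.coe_add, circ_add_left,
        circ_add_right g.2.1.1, smul_add]
      abel))
    (fun c f g => Subtype.ext (by
      simp only [gerstenhaberBracket, Submodule.coe_smul, circ_smul_left,
        circ_smul_right c g.2.1.1, smul_sub, smul_comm c]))
    (fun f g g' => Subtype.ext (by
      simp only [gerstenhaberBracket, Submodule.coe_add, circ_add_left,
        circ_add_right f.2.1.1, smul_add]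
      abel))
    (fun c f g => Subtype.ext (by
      simp only [gerstenhaberBracket, Submodule.coe_smul, circ_smul_left,
        circ_smul_right c f.2.1.1, smul_sub, smul_comm c]))

theorem cochainBracket_coe {i j l : ℤ} (h : i + j = l + 1) (f : harrisonCochains k A i)
    (g : harrisonCochains k A j) :
    (cochainBracket h f g : List A → A) = gerstenhaberBracket i j f g := rfl

theorem cochainBracket_symm {i j l : ℤ} (h : i + j = l + 1) (h' : j + i = l + 1)
    (f : harrisonCochains k A i) (g : harrisonCochains k A j) :
    cochainBracket h f g = -(((i - 1) * (j - 1)).negOnePow • cochainBracket h' g f) := by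
  refine Subtype.ext ?_
  rw [Units.smul_def, Submodule.coe_neg, Submodule.coe_smul_of_tower, ← Units.smul_def,
    cochainBracket_coe, cochainBracket_coe, gerstenhaberBracket, gerstenhaberBracket, smul_sub,
    smul_smul, mul_comm (j - 1), Int.units_mul_self, one_smul, neg_sub]

variable (k A) in
/-- The differential `b = [μ₀, ·]` on Harrison cochains, where `μ₀` is the product of `A`; it is
the Hochschild coboundary up to a global sign in each degree. -/
def differential {i l : ℤ} (h : i + 1 = l) :
    harrisonCochains k A i →ₗ[k] harrisonCochains k A l :=
  cochainBracket (show 2 + i = l + 1 by omega) ⟨mulCochain A, mulCochain_mem k A⟩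

theorem cochain_jacobi {a b c d e p q : ℤ} (hd : b + c = d + 1) (he : a + b = e + 1)
    (hp : a + c = p + 1) (h1 : a + d = q + 1) (h2 : e + c = q + 1) (h3 : b + p = q + 1)
    (f : harrisonCochains k A a) (g : harrisonCochains k A b) (h : harrisonCochains k A c) :
    cochainBracket h1 f (cochainBracket hd g h) =
      cochainBracket h2 (cochainBracket he f g) h +
        ((a - 1) * (b - 1)).negOnePow • cochainBracket h3 g (cochainBracket hp f h) :=
  Subtype.ext (by
    rw [Units.smul_def, Submodule.coe_add, Submodule.coe_smul_of_tower, ← Units.smul_def]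
    exact jacobi f.2 g.2 h.2 hd he hp)

theorem mul_bracket_mul (h : (2 : ℤ) + 2 = 3 + 1) :
    cochainBracket (k := k) (A := A) h ⟨mulCochain A, mulCochain_mem k A⟩
      ⟨mulCochain A, mulCochain_mem k A⟩ = 0 := by
  have hc : circ (mulCochain A) (mulCochain A) = 0 := by
    funext l
    by_cases hl : l.length = 3
    · match l, hl with
      | [a, b, c], _ =>
        simp [circ, Finset.sum_range_succ, mulCochain]
        ring
    · exact (circ_mem_hochschildCochains h (mulCochain_mem k A).1 (mulCochain_mem k A).1).2 l
        (by omega)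
  refine Subtype.ext ?_
  rw [cochainBracket_coe, gerstenhaberBracket]
  simp only [hc, smul_zero, sub_zero]
  rfl

/-- `b [f, g] = [b f, g] + (-1)^{|f|} [f, b g]` -/
theorem differential_bracket {i j l i' j' l' : ℤ} (h : i + j = l + 1) (hi : i + 1 = i')
    (hj : j + 1 = j') (hl : l + 1 = l') (f : harrisonCochains k A i) (g : harrisonCochains k A j) :
    differential k A hl (cochainBracket h f g) =
      cochainBracket (show i' + j = l' + 1 by omega) (differential k A hi f) g +
        (i - 1).negOnePow •
          cochainBracket (show i + j' = l' + 1 by omega) f (differential k A hj g) := by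
  have := cochain_jacobi (k := k) (A := A) h (show 2 + i = i' + 1 by omega)
    (show 2 + j = j' + 1 by omega) (show 2 + l = l' + 1 by omega)
    (show i' + j = l' + 1 by omega) (show i + j' = l' + 1 by omega)
    ⟨mulCochain A, mulCochain_mem k A⟩ f g
  rw [show (2 - 1) * (i - 1) = i - 1 by ring] at this
  exact this

theorem differential_differential [CharZero k] {i j l : ℤ} (h : i + 1 = j) (h' : j + 1 = l)
    (f : harrisonCochains k A i) : differential k A h' (differential k A h f) = 0 := by
  have := cochain_jacobi (k := k) (A := A) (show 2 + i = j + 1 by omega)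
    (show (2 : ℤ) + 2 = 3 + 1 by norm_num) (show 2 + i = j + 1 by omega)
    (show 2 + j = l + 1 by omega) (show 3 + i = l + 1 by omega) (show 2 + j = l + 1 by omega)
    ⟨mulCochain A, mulCochain_mem k A⟩ ⟨mulCochain A, mulCochain_mem k A⟩ f
  rw [mul_bracket_mul, map_zero, LinearMap.zero_apply, zero_add,
    show ((2 : ℤ) - 1) * (2 - 1) = 1 by norm_num, Int.negOnePow_one, Units.neg_smul, one_smul] at this
  have h2 : (2 : k) • differential k A h' (differential k A h f) = 0 := by
    rw [two_smul]
    exact add_eq_zero_iff_eq_neg.2 this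
  exact (smul_eq_zero.1 h2).resolve_left two_ne_zero

variable (k A)

/-- The Harrison cocycles of degree `n`. -/
def harrisonCocycles (n : ℤ) : Submodule k (harrisonCochains k A n) :=
  LinearMap.ker (differential k A (rfl : n + 1 = n + 1))

instance (n : ℤ) : AddCommGroup (harrisonCocycles k A n) := Submodule.addCommGroup _

/-- The Harrison coboundaries of degree `n`. -/
def harrisonCoboundaries (n : ℤ) : Submodule k (harrisonCochains k A n) :=
  LinearMap.range (differential k A (sub_add_cancel n 1))

/-- The Harrison cohomology `Harrⁿ(A, A)`: cocycles modulo coboundaries. -/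
abbrev HarrisonCohomology (n : ℤ) : Type _ :=
  harrisonCocycles k A n ⧸ (harrisonCoboundaries k A n).submoduleOf (harrisonCocycles k A n)

/-- The class of a Harrison cocycle. -/
def cohomologyClass (n : ℤ) : harrisonCocycles k A n →ₗ[k] HarrisonCohomology k A n :=
  Submodule.mkQ _

variable {k A}

theorem bracket_mem_cocycles {i j l : ℤ} (h : i + j = l + 1) (f : harrisonCocycles k A i)
    (g : harrisonCocycles k A j) : cochainBracket h f.1 g.1 ∈ harrisonCocycles k A l := by
  have hf := LinearMap.mem_ker.1 f.2
  have hg := LinearMap.mem_ker.1 g.2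
  rw [harrisonCocycles, LinearMap.mem_ker, differential_bracket h rfl rfl rfl, hf, hg]
  simp

/-- The Gerstenhaber bracket on Harrison cocycles. -/
def cocycleBracket {i j l : ℤ} (h : i + j = l + 1) :
    harrisonCocycles k A i →ₗ[k] harrisonCocycles k A j →ₗ[k] harrisonCocycles k A l :=
  LinearMap.mk₂ k (fun f g => ⟨cochainBracket h f.1 g.1, bracket_mem_cocycles h f g⟩)
    (fun f f' g => Subtype.ext (by simp)) (fun c f g => Subtype.ext (by simp))
    (fun f g g' => Subtype.ext (by simp)) (fun c f g => Subtype.ext (by simp))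

variable (k A) in
/-- The graded Lie bracket `[·, ·]_s` induced by the Gerstenhaber bracket on Harrison cohomology. -/
def cohomologyBracket {i j l : ℤ} (h : i + j = l + 1) :
    HarrisonCohomology k A i →ₗ[k] HarrisonCohomology k A j →ₗ[k] HarrisonCohomology k A l :=
  LinearMap.liftQ₂ _ _ ((cocycleBracket h).compr₂ (cohomologyClass k A l))
    (by
      rintro ⟨f, hf⟩ hf'
      obtain ⟨u, rfl⟩ := hf'
      refine LinearMap.ext fun ⟨g, hg⟩ => ?_
      refine (Submodule.Quotient.mk_eq_zero _).2 ⟨cochainBracket (show i - 1 + j = l - 1 + 1 by omega) u g, ?_⟩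
      rw [differential_bracket _ (sub_add_cancel i 1) rfl, LinearMap.mem_ker.1 hg]
      simp
      rfl)
    (by
      rintro ⟨g, hg⟩ hg'
      obtain ⟨u, rfl⟩ := hg'
      refine LinearMap.ext fun ⟨f, hf⟩ => ?_
      refine (Submodule.Quotient.mk_eq_zero _).2 ⟨(i - 1).negOnePow •
        cochainBracket (show i + (j - 1) = l - 1 + 1 by omega) f u, ?_⟩
      rw [Units.smul_def, map_zsmul, differential_bracket _ rfl (sub_add_cancel j 1),
        LinearMap.mem_ker.1 hf, map_zero, LinearMap.zero_apply, zero_add, ← Units.smul_def,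
        smul_smul, Int.units_mul_self, one_smul]
      rfl)

theorem cohomologyBracket_class {i j l : ℤ} (h : i + j = l + 1) (f : harrisonCocycles k A i)
    (g : harrisonCocycles k A j) :
    cohomologyBracket k A h (cohomologyClass k A i f) (cohomologyClass k A j g) =
      cohomologyClass k A l (cocycleBracket h f g) := rfl

theorem cohomologyBracket_symm {i j l : ℤ} (h : i + j = l + 1) (h' : j + i = l + 1)
    (x : HarrisonCohomology k A i) (y : HarrisonCohomology k A j) :
    cohomologyBracket k A h x y = -(((i - 1) * (j - 1)).negOnePow • cohomologyBracket k A h' y x) := by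
  obtain ⟨f, rfl⟩ := Submodule.mkQ_surjective _ x
  obtain ⟨g, rfl⟩ := Submodule.mkQ_surjective _ y
  change cohomologyClass k A l (cocycleBracket h f g) =
    -(_ • cohomologyClass k A l (cocycleBracket h' g f))
  rw [Units.smul_def, ← map_zsmul, ← map_neg]
  congr 1
  refine Subtype.ext ?_
  rw [Submodule.coe_neg, Submodule.coe_smul_of_tower, ← Units.smul_def]
  exact cochainBracket_symm h h' f.1 g.1

end Cohomology

noncomputable section Formality

open DirectSum

variable (k A : Type*) [Field k] [CommRing A] [Algebra k A]

/-- The graded vector space `C[2]`, where `C` is the Harrison complex. -/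
abbrev ShiftedCochains (i : ℤ) : Type _ := harrisonCochains k A (i + 2)

/-- The graded vector space `H[2]`, where `H` is the Harrison cohomology. -/
abbrev ShiftedCohomology (i : ℤ) : Type _ := HarrisonCohomology k A (i + 2)

/-- A family of bilinear maps `V i × V j → V (i + j + 1)`, as a bilinear map on `⨁ i, V i`. -/
def totalBilinear {V : ℤ → Type*} [∀ i, AddCommGroup (V i)] [∀ i, Module k (V i)]
    (D : ∀ i j, V i →ₗ[k] V j →ₗ[k] V (i + j + 1)) :
    (⨁ i, V i) →ₗ[k] (⨁ i, V i) →ₗ[k] ⨁ i, V i :=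
  toModule k ℤ _ fun i => (toModule k ℤ _ fun j =>
    ((D i j).compr₂ (lof k ℤ V (i + j + 1))).flip).flip

theorem totalBilinear_lof {V : ℤ → Type*} [∀ i, AddCommGroup (V i)] [∀ i, Module k (V i)]
    (D : ∀ i j, V i →ₗ[k] V j →ₗ[k] V (i + j + 1)) (i j : ℤ) (x : V i) (y : V j) :
    totalBilinear k D (lof k ℤ V i x) (lof k ℤ V j y) = lof k ℤ V (i + j + 1) (D i j x y) := by
  simp [totalBilinear]

/-- The differential `b` of `C[2]`. -/
def shiftedDifferential : (⨁ i, ShiftedCochains k A i) →ₗ[k] ⨁ i, ShiftedCochains k A i :=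
  toModule k ℤ _ fun i => lof k ℤ (ShiftedCochains k A) (i + 1) ∘ₗ
    differential k A (show i + 2 + 1 = i + 1 + 2 by ring)

/-- The shifted bracket `D = [·, ·]_G[1]` on `C[2]`, i.e. `D(x, y) = (-1)^{|x|} [x, y]_G`. -/
def shiftedCochainBracket : (⨁ i, ShiftedCochains k A i) →ₗ[k]
    (⨁ i, ShiftedCochains k A i) →ₗ[k] ⨁ i, ShiftedCochains k A i :=
  totalBilinear k fun i j => ((i.negOnePow : ℤ) : k) •
    cochainBracket (show i + 2 + (j + 2) = i + j + 1 + 2 + 1 by ring)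

/-- The shifted bracket `d = [·, ·]_s[1]` on `H[2]`, i.e. `d(x, y) = (-1)^{|x|} [x, y]_s`. -/
def shiftedCohomologyBracket : (⨁ i, ShiftedCohomology k A i) →ₗ[k]
    (⨁ i, ShiftedCohomology k A i) →ₗ[k] ⨁ i, ShiftedCohomology k A i :=
  totalBilinear k fun i j => ((i.negOnePow : ℤ) : k) •
    cohomologyBracket k A (show i + 2 + (j + 2) = i + j + 1 + 2 + 1 by ring)

theorem shifted_sign (i j : ℤ) : ((i.negOnePow : ℤ) : k) * -((((i + 2 - 1) * (j + 2 - 1)).negOnePow : ℤ) : k)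
    = (((i * j).negOnePow : ℤ) : k) * ((j.negOnePow : ℤ) : k) := by
  rw [show (i + 2 - 1) * (j + 2 - 1) = i * j + i + (j + 1) by ring, Int.negOnePow_add,
    Int.negOnePow_succ, Int.negOnePow_add]
  rcases Int.even_or_odd i with hi | hi <;> rcases Int.even_or_odd j with hj | hj <;>
    simp [Int.negOnePow_even, Int.negOnePow_odd, *]

theorem shiftedCochainBracket_symm :
    GradedSym.IsGradedSymmetric k (shiftedCochainBracket k A) := by
  intro i j x y
  have key : ∀ {n n' : ℤ} (hn : n = n') (h : i + 2 + (j + 2) = n + 2 + 1)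
      (h' : j + 2 + (i + 2) = n' + 2 + 1),
      lof k ℤ (ShiftedCochains k A) n (((i.negOnePow : ℤ) : k) • cochainBracket h x y) =
      (((i * j).negOnePow : ℤ) : k) • lof k ℤ (ShiftedCochains k A) n'
        (((j.negOnePow : ℤ) : k) • cochainBracket h' y x) := by
    intro n n' hn h h'
    subst hn
    rw [cochainBracket_symm h h', Units.smul_def, ← Int.cast_smul_eq_zsmul k, ← neg_smul,
      smul_smul, shifted_sign, mul_smul, LinearMap.map_smul (lof k ℤ _ n)]
  rw [shiftedCochainBracket, totalBilinear_lof, totalBilinear_lof, Units.smul_def,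
    ← Int.cast_smul_eq_zsmul k]
  exact key (by ring) _ _

theorem shiftedCohomologyBracket_symm :
    GradedSym.IsGradedSymmetric k (shiftedCohomologyBracket k A) := by
  intro i j x y
  have key : ∀ {n n' : ℤ} (hn : n = n') (h : i + 2 + (j + 2) = n + 2 + 1)
      (h' : j + 2 + (i + 2) = n' + 2 + 1),
      lof k ℤ (ShiftedCohomology k A) n (((i.negOnePow : ℤ) : k) • cohomologyBracket k A h x y) =
      (((i * j).negOnePow : ℤ) : k) • lof k ℤ (ShiftedCohomology k A) n'
        (((j.negOnePow : ℤ) : k) • cohomologyBracket k A h' y x) := by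
    intro n n' hn h h'
    subst hn
    rw [cohomologyBracket_symm h h', Units.smul_def, ← Int.cast_smul_eq_zsmul k, ← neg_smul,
      smul_smul, shifted_sign, mul_smul, LinearMap.map_smul (lof k ℤ _ n)]
  rw [shiftedCohomologyBracket, totalBilinear_lof, totalBilinear_lof, Units.smul_def,
    ← Int.cast_smul_eq_zsmul k]
  exact key (by ring) _ _

/-- The coderivation of `Sym(C[2])` induced by `b + D`. -/
def cochainCodifferential :
    GradedSym k (ShiftedCochains k A) →ₗ[k] GradedSym k (ShiftedCochains k A) :=
  GradedSym.coderivation k (GradedSym.corestriction k (shiftedDifferential k A)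
    (shiftedCochainBracket k A) (shiftedCochainBracket_symm k A))

/-- The coderivation of `Sym(H[2])` induced by `d`. -/
def cohomologyCodifferential :
    GradedSym k (ShiftedCohomology k A) →ₗ[k] GradedSym k (ShiftedCohomology k A) :=
  GradedSym.coderivation k (GradedSym.corestriction k 0
    (shiftedCohomologyBracket k A) (shiftedCohomologyBracket_symm k A))

/-- `Φ : Sym(H[2]) → Sym(C[2])` is a formality map, where `C` and `H` are the Harrison complex and
cohomology of `A`: a morphism of differential graded coalgebras of degree zero (i.e. an
`L_∞`-morphism) whose restriction to `H[2]`, projected to `C[2]`, is a section, i.e. sends every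
cohomology class to a cocycle representing it. -/
structure IsFormalityMap
    (Φ : GradedSym k (ShiftedCohomology k A) →ₗ[k] GradedSym k (ShiftedCochains k A)) : Prop where
  degree_zero : ∀ n, ∀ x ∈ GradedSym.grading k (ShiftedCohomology k A) n,
    Φ x ∈ GradedSym.grading k (ShiftedCochains k A) n
  map_one : Φ 1 = 1
  counit_comp : ∀ x, GradedSym.counit k (ShiftedCochains k A) (Φ x) =
    GradedSym.counit k (ShiftedCohomology k A) x
  comul_comp : TensorProduct.map Φ Φ ∘ₗ GradedSym.comul k (ShiftedCohomology k A) =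
    GradedSym.comul k (ShiftedCochains k A) ∘ₗ Φ
  codifferential_comp : cochainCodifferential k A ∘ₗ Φ = Φ ∘ₗ cohomologyCodifferential k A
  isSection : ∀ (i : ℤ) (h : ShiftedCohomology k A i),
    ∃ z : harrisonCocycles k A (i + 2), cohomologyClass k A (i + 2) z = h ∧
      GradedSym.proj k (ShiftedCochains k A)
        (Φ (GradedSym.ι k (ShiftedCohomology k A) (lof k ℤ (ShiftedCohomology k A) i h))) =
      lof k ℤ (ShiftedCochains k A) i z.1

/-- The commutative algebra `A` is formal: its Harrison complex admits a formality map. -/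
def IsHarrisonFormal : Prop :=
  ∃ Φ : GradedSym k (ShiftedCohomology k A) →ₗ[k] GradedSym k (ShiftedCochains k A),
    IsFormalityMap k A Φ

variable {k A}

/-- The product `F * G = ∑ λⁿ μₙ(F, G)` on `A[[λ]]`, where the `k`-bilinear maps `μₙ` on `A` are
extended `λ`-bilinearly: its `λⁿ`-coefficient is the sum of the `μ_r(F_i, G_j)`, `r + i + j = n`. -/
def starProduct (μ : ℕ → A →ₗ[k] A →ₗ[k] A) (F G : PowerSeries A) : PowerSeries A :=
  PowerSeries.mk fun n => ∑ p ∈ Finset.HasAntidiagonal.antidiagonal n, ∑ q ∈ Finset.HasAntidiagonal.antidiagonal p.2,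
    μ p.1 (PowerSeries.coeff q.1 F) (PowerSeries.coeff q.2 G)

/-- The bilinear maps `μ₀, μ₁, …` define a formal commutative associative deformation of `A`: `μ₀` is
the product of `A`, and `∑ λⁿ μₙ` is a commutative and associative product on `A[[λ]]`. -/
structure IsFormalCommDeformation (μ : ℕ → A →ₗ[k] A →ₗ[k] A) : Prop where
  zero : μ 0 = LinearMap.mul k A
  comm : ∀ F G, starProduct μ F G = starProduct μ G F
  assoc : ∀ F G K, starProduct μ (starProduct μ F G) K = starProduct μ F (starProduct μ G K)

/-- A bilinear map on `A` as a 2-cochain. -/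
def bilinearCochain (β : A →ₗ[k] A →ₗ[k] A) : List A → A
  | [a, b] => β a b
  | _ => 0

end Formality
end Harrison

namespace Harrison

namespace GradedSym

noncomputable section

/-! The argument transports Maurer–Cartan elements along the formality map. The condition on `π`
says that `λπ` is a Maurer–Cartan element of `H[[λ]]` with zero differential. It lies in degree 0 of
`H[2]`, and the extra factor `λ` makes its exponential in `Sym(H[2])` a well-defined formal series.
That exponential is group-like (`comul_expSeq`) and is annihilated by the codifferential
(`cohomologyCodifferential_expSeq`).

A morphism of coalgebras sends group-like series to group-like series, and `Φ` intertwines the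
codifferentials. The image is therefore a group-like series in `Sym(C[2])` annihilated by the
codifferential of `b + D`. Let `y = ∑ λⁿ yₙ` be its projection to `C[2]`. Since `Φ` has degree 0,
each `yₙ` is a Harrison 2-cochain, and `y₀ = 0` because `Φ 1 = 1`. Projecting the closedness
equation to `C[2]` gives `b y + ½ [y, y]_G = 0` (`exists_maurerCartan`). To first order `y₁` is
`Φ₁(π₀)`, a cocycle representing `π₀`.

The Maurer–Cartan equation for `y` is `[μ₀ + y, μ₀ + y]_G = 0` (`sum_bracket_eq_zero`). For
2-cochains in characteristic 0 this is associativity of `μ₀ + y` (`sum_circ_eq_zero`,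
`circ_toBilinear`). Vanishing on the shuffle of two letters is commutativity (`toBilinear_comm`).

No basis of `Sym V` is needed, nor the general theory of coderivations. A codifferential is only
evaluated on group-like series, where its projection is its corestriction
(`IsGroupLikeSeq.proj_coderivation`). The quadratic part of the corestriction is read off from the
comultiplication (`lift_proj_comul`). Series in `λ` are handled throughout as sequences of
coefficients. -/

theorem sum_antidiagonal_assoc {W : Type*} [AddCommMonoid W] (n : ℕ) (f : ℕ → ℕ → ℕ → W) :
    ∑ p ∈ Finset.HasAntidiagonal.antidiagonal n,
      ∑ q ∈ Finset.HasAntidiagonal.antidiagonal p.2, f p.1 q.1 q.2 =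
    ∑ p ∈ Finset.HasAntidiagonal.antidiagonal n,
      ∑ q ∈ Finset.HasAntidiagonal.antidiagonal p.1, f q.1 q.2 p.2 := by
  rw [Finset.sum_sigma', Finset.sum_sigma']
  refine Finset.sum_nbij' (fun x => ⟨(x.1.1 + x.2.1, x.2.2), (x.1.1, x.2.1)⟩)
    (fun x => ⟨(x.2.1, x.2.2 + x.1.2), (x.2.2, x.1.2)⟩) ?_ ?_ ?_ ?_ fun _ _ => rfl
  all_goals
    rintro ⟨⟨a, b⟩, ⟨c, d⟩⟩ h
    simp only [Finset.mem_sigma, Finset.HasAntidiagonal.mem_antidiagonal] at h ⊢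
    obtain ⟨rfl, rfl⟩ := h
    simp [add_assoc]

/-! ### Counit and low-degree components of the graded symmetric algebra -/

variable (k : Type*) [Field k] (V : ℤ → Type*) [∀ i, AddCommGroup (V i)] [∀ i, Module k (V i)]

-- The graded pieces are spanned by monomials by definition, and a monomial arises from `1` by
-- successive left multiplication with homogeneous generators. The identities for linear maps on
-- `Sym V` below are proved by this principle.
variable {k V} in
theorem induction_ι_mul {P : GradedSym k V → Prop} (x : GradedSym k V) (one : P 1)
    (add : ∀ x y, P x → P y → P (x + y)) (smul : ∀ (c : k) x, P x → P (c • x))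
    (mul : ∀ i (v : V i) x, P x → P (ι k V (DirectSum.lof k ℤ V i v) * x)) : P x := by
  have zero : P 0 := by simpa using smul 0 1 one
  induction x using DirectSum.Decomposition.inductionOn (grading k V) with
  | zero => exact zero
  | add x y hx hy => exact add x y hx hy
  | @homogeneous i x =>
    obtain ⟨x, hx⟩ := x
    induction hx using Submodule.span_induction with
    | mem x h =>
      obtain ⟨l, -, rfl⟩ := h
      dsimp only
      clear * - one mul
      induction l with
      | nil => simpa [monomial] using one
      | cons p l ih => simpa [monomial] using mul p.1 p.2 _ ih
    | zero => exact zero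
    | add x y _ _ hx hy => exact add x y hx hy
    | smul c x _ hx => exact smul c x hx

theorem counit_ι_mul (v : ⨁ i, V i) (x : GradedSym k V) : counit k V (ι k V v * x) = 0 := by
  rw [map_mul, counit, lift_ι]; simp

theorem truncation_one (D : (⨁ i, V i) →ₗ[k] (⨁ i, V i) →ₗ[k] ⨁ i, V i)
    (hD : IsGradedSymmetric k D) : truncation k D hD 1 = (1, 0, 0) := by
  simp [truncation]

/-- A generator acts on triples through `truncationGen`, which pushes `k` into the first copy of `V`
and that copy through `D v` into the second. With the value at `1`, this recursion determines
`truncation`; it also shows that the first two components do not depend on `D`. -/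
theorem truncation_ι_mul (D : (⨁ i, V i) →ₗ[k] (⨁ i, V i) →ₗ[k] ⨁ i, V i)
    (hD : IsGradedSymmetric k D) (v : ⨁ i, V i) (x : GradedSym k V) :
    truncation k D hD (ι k V v * x) =
      (0, (truncation k D hD x).1 • v, D v (truncation k D hD x).2.1) := by
  simp [truncation, lift_ι, truncationGen]

theorem truncation_fst (D : (⨁ i, V i) →ₗ[k] (⨁ i, V i) →ₗ[k] ⨁ i, V i)
    (hD : IsGradedSymmetric k D) (x : GradedSym k V) :
    (truncation k D hD x).1 = counit k V x := by
  induction x using induction_ι_mul with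
  | one => simp [truncation_one]
  | add x y hx hy => simp [hx, hy]
  | smul c x hx => simp [hx]
  | mul i v x _ => rw [truncation_ι_mul, counit_ι_mul]

theorem proj_one : proj k V 1 = 0 := by
  simp [proj, truncation_one]

theorem proj_ι_mul (v : ⨁ i, V i) (x : GradedSym k V) :
    proj k V (ι k V v * x) = counit k V x • v := by
  simp [proj, truncation_ι_mul, truncation_fst]

theorem truncation_snd_fst (D : (⨁ i, V i) →ₗ[k] (⨁ i, V i) →ₗ[k] ⨁ i, V i)
    (hD : IsGradedSymmetric k D) (x : GradedSym k V) :
    (truncation k D hD x).2.1 = proj k V x := by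
  induction x using induction_ι_mul with
  | one => simp [truncation_one, proj_one]
  | add x y hx hy => simp [hx, hy]
  | smul c x hx => simp [hx]
  | mul i v x _ => rw [truncation_ι_mul, truncation_fst, proj_ι_mul]

/-- Only the empty monomial survives the counit, and its degree is 0. This removes the Koszul sign
in `counitLeft_comul`. -/
theorem counit_eq_zero {j : ℤ} (hj : j ≠ 0) {x : GradedSym k V} (hx : x ∈ grading k V j) :
    counit k V x = 0 := by
  induction hx using Submodule.span_induction with
  | mem x h =>
    obtain ⟨l, hl, rfl⟩ := h
    cases l with
    | nil => exact absurd hl.symm (by simpa using hj)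
    | cons p l => simpa [monomial] using counit_ι_mul k V _ _
  | zero => simp
  | add x y _ _ hx hy => simp [hx, hy]
  | smul c x _ hx => simp [hx]

/-- Monomials of length 0 or at least 2 project to zero, and a single letter has its own degree.
This is how the projection of a degree 0 element of `Sym(C[2])` becomes an actual 2-cochain. -/
theorem exists_proj_eq {j : ℤ} {x : GradedSym k V} (hx : x ∈ grading k V j) :
    ∃ v : V j, proj k V x = DirectSum.lof k ℤ V j v := by
  induction hx using Submodule.span_induction with
  | mem x h =>
    obtain ⟨l, hl, rfl⟩ := h
    rcases l with _ | ⟨⟨i, v⟩, _ | ⟨q, l⟩⟩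
    · exact ⟨0, by simp [monomial, proj_one]⟩
    · obtain rfl : i = j := by simpa using hl
      have := proj_ι_mul k V (DirectSum.lof k ℤ V i v) 1
      exact ⟨v, by simpa [monomial] using this⟩
    · refine ⟨0, ?_⟩
      have := proj_ι_mul k V (DirectSum.lof k ℤ V i v) (monomial k V (q :: l))
      simp only [monomial, List.map_cons, List.prod_cons, counit_ι_mul, zero_smul] at this ⊢
      rw [this, map_zero]
  | zero => exact ⟨0, by simp⟩
  | add x y _ _ hx hy =>
    obtain ⟨v, hv⟩ := hx
    obtain ⟨w, hw⟩ := hy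
    exact ⟨v + w, by simp [hv, hw]⟩
  | smul c x _ hx =>
    obtain ⟨v, hv⟩ := hx
    exact ⟨c • v, by rw [map_smul, map_smul, hv]⟩

theorem proj_ι (v : ⨁ i, V i) : proj k V (ι k V v) = v := by
  simpa using proj_ι_mul k V v 1

/-! ### The comultiplication and the counit axioms -/

/-- Multiplication by `1 ⊗ v` on `Sym V ⊗ Sym V`, with the Koszul sign rule. -/
def rightMul (v : ⨁ i, V i) : GradedSym k V ⊗[k] GradedSym k V →ₗ[k]
    GradedSym k V ⊗[k] GradedSym k V :=
  ((GradedTensorProduct.of k (grading k V) (grading k V)).symm : _ →ₗ[k] _) ∘ₗ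
    GradedTensorProduct.mulHom (R := k) (grading k V) (grading k V)
      (GradedTensorProduct.includeRight (grading k V) (grading k V) (ι k V v)) ∘ₗ
    ((GradedTensorProduct.of k (grading k V) (grading k V)) : _ →ₗ[k] _)

theorem rightMul_tmul {i j : ℤ} (v : V i) {a : GradedSym k V} (ha : a ∈ grading k V j)
    (b : GradedSym k V) : rightMul k V (DirectSum.lof k ℤ V i v) (a ⊗ₜ b) =
      (i * j).negOnePow • (a ⊗ₜ[k] (ι k V (DirectSum.lof k ℤ V i v) * b)) := by
  have h := GradedTensorProduct.tmul_coe_mul_coe_tmul (R := k) (grading k V) (grading k V)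
    (1 : GradedSym k V) ⟨_, ι_mem k V i v⟩ ⟨a, ha⟩ b
  rw [one_mul] at h
  exact congrArg (GradedTensorProduct.of k (grading k V) (grading k V)).symm h

/-- Moving a generator of degree 0 past `a` costs no sign, so `a` need not be homogeneous. -/
theorem rightMul_tmul_of_degree_zero (v : V 0) (a b : GradedSym k V) :
    rightMul k V (DirectSum.lof k ℤ V 0 v) (a ⊗ₜ b) =
      a ⊗ₜ[k] (ι k V (DirectSum.lof k ℤ V 0 v) * b) := by
  induction a using DirectSum.Decomposition.inductionOn (grading k V) with
  | zero => simp
  | add x y hx hy => rw [TensorProduct.add_tmul, map_add, hx, hy, TensorProduct.add_tmul]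
  | homogeneous x => rw [rightMul_tmul k V v x.2]; simp

/-- Multiplication by `v ⊗ 1` on `Sym V ⊗ Sym V`. -/
def leftMul (v : ⨁ i, V i) : GradedSym k V ⊗[k] GradedSym k V →ₗ[k]
    GradedSym k V ⊗[k] GradedSym k V :=
  ((GradedTensorProduct.of k (grading k V) (grading k V)).symm : _ →ₗ[k] _) ∘ₗ
    GradedTensorProduct.mulHom (R := k) (grading k V) (grading k V)
      (GradedTensorProduct.includeLeft (grading k V) (grading k V) (ι k V v)) ∘ₗ
    ((GradedTensorProduct.of k (grading k V) (grading k V)) : _ →ₗ[k] _)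

theorem leftMul_tmul (v : ⨁ i, V i) (a b : GradedSym k V) :
    leftMul k V v (a ⊗ₜ b) = (ι k V v * a) ⊗ₜ[k] b := by
  induction a using DirectSum.Decomposition.inductionOn (grading k V) with
  | zero => simp
  | add x y hx hy => rw [TensorProduct.add_tmul, map_add, hx, hy, mul_add, TensorProduct.add_tmul]
  | homogeneous x =>
    exact congrArg (GradedTensorProduct.of k (grading k V) (grading k V)).symm
      (GradedTensorProduct.tmul_one_mul_coe_tmul (R := k) (grading k V) (grading k V)
        (ι k V v) x b)

theorem comul_one : comul k V 1 = 1 ⊗ₜ[k] 1 := by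
  simp only [comul, LinearMap.comp_apply, AlgHom.toLinearMap_apply, map_one]
  rfl

/-- The comultiplication is multiplicative and `v` is primitive. In this recursive form it can be
combined with `induction_ι_mul`. -/
theorem comul_ι_mul (v : ⨁ i, V i) (x : GradedSym k V) :
    comul k V (ι k V v * x) = leftMul k V v (comul k V x) + rightMul k V v (comul k V x) := by
  have h : comulHom k V (ι k V v * x) =
      GradedTensorProduct.includeLeft (grading k V) (grading k V) (ι k V v) * comulHom k V x +
      GradedTensorProduct.includeRight (grading k V) (grading k V) (ι k V v) * comulHom k V x := by
    rw [map_mul, ← add_mul]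
    congr 1
    exact lift_ι k V _ _ v
  have h' := congrArg (GradedTensorProduct.of k (grading k V) (grading k V)).symm h
  rw [map_add] at h'
  exact h'

variable {k V} in
theorem tensor_hom_ext {W : Type*} [AddCommGroup W] [Module k W]
    {f g : GradedSym k V ⊗[k] GradedSym k V →ₗ[k] W}
    (h : ∀ j, ∀ a ∈ grading k V j, ∀ b, f (a ⊗ₜ b) = g (a ⊗ₜ b)) : f = g := by
  refine TensorProduct.ext' fun a b => ?_
  induction a using DirectSum.Decomposition.inductionOn (grading k V) with
  | zero => simp
  | add x y hx hy => rw [TensorProduct.add_tmul, map_add, map_add, hx, hy]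
  | homogeneous x => exact h _ _ x.2 b

/-- The contraction `a ⊗ b ↦ ε(a) b`. -/
def counitLeft : GradedSym k V ⊗[k] GradedSym k V →ₗ[k] GradedSym k V :=
  TensorProduct.lift (LinearMap.lsmul k (GradedSym k V) ∘ₗ (counit k V).toLinearMap)

/-- The contraction `a ⊗ b ↦ ε(b) a`. -/
def counitRight : GradedSym k V ⊗[k] GradedSym k V →ₗ[k] GradedSym k V :=
  TensorProduct.lift (LinearMap.lsmul k (GradedSym k V) ∘ₗ (counit k V).toLinearMap).flip

theorem counitLeft_tmul (a b : GradedSym k V) : counitLeft k V (a ⊗ₜ b) = counit k V a • b := by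
  simp [counitLeft]

theorem counitRight_tmul (a b : GradedSym k V) : counitRight k V (a ⊗ₜ b) = counit k V b • a := by
  simp [counitRight]

/-- By induction on monomials: in `Δ(v x) = (v ⊗ 1 + 1 ⊗ v) Δ x` the first summand is killed, since
the counit vanishes on multiples of `v`, and the second becomes left multiplication by `v`. -/
theorem counitLeft_comul (x : GradedSym k V) : counitLeft k V (comul k V x) = x := by
  induction x using induction_ι_mul with
  | one => rw [comul_one, counitLeft_tmul, map_one, one_smul]
  | add x y hx hy => rw [map_add, map_add, hx, hy]
  | smul c x hx => rw [map_smul, map_smul, hx]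
  | mul i v x hx =>
    have hl : counitLeft k V ∘ₗ leftMul k V (DirectSum.lof k ℤ V i v) = 0 :=
      tensor_hom_ext fun j a ha b => by
        simp [leftMul_tmul, counitLeft_tmul, counit_ι_mul, -map_mul]
    have hr : counitLeft k V ∘ₗ rightMul k V (DirectSum.lof k ℤ V i v) =
        LinearMap.mulLeft k (ι k V (DirectSum.lof k ℤ V i v)) ∘ₗ counitLeft k V :=
      tensor_hom_ext fun j a ha b => by
        rw [LinearMap.comp_apply, LinearMap.comp_apply, rightMul_tmul k V v ha, Units.smul_def,
          map_zsmul, counitLeft_tmul, counitLeft_tmul, LinearMap.mulLeft_apply]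
        -- The sign `(-1)^(i j)` is trivial for `j = 0`; for `j ≠ 0` both sides vanish because the
        -- counit of `a` does.
        rcases eq_or_ne j 0 with rfl | hj
        · simp
        · simp [counit_eq_zero k V hj ha]
    rw [comul_ι_mul, map_add]
    have h1 := LinearMap.congr_fun hl (comul k V x)
    have h2 := LinearMap.congr_fun hr (comul k V x)
    simp only [LinearMap.comp_apply, LinearMap.zero_apply, LinearMap.mulLeft_apply] at h1 h2
    rw [h1, h2, hx, zero_add]

theorem counitRight_comul (x : GradedSym k V) : counitRight k V (comul k V x) = x := by
  induction x using induction_ι_mul with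
  | one => rw [comul_one, counitRight_tmul, map_one, one_smul]
  | add x y hx hy => rw [map_add, map_add, hx, hy]
  | smul c x hx => rw [map_smul, map_smul, hx]
  | mul i v x hx =>
    have hl : counitRight k V ∘ₗ leftMul k V (DirectSum.lof k ℤ V i v) =
        LinearMap.mulLeft k (ι k V (DirectSum.lof k ℤ V i v)) ∘ₗ counitRight k V :=
      tensor_hom_ext fun j a ha b => by
        simp [leftMul_tmul, counitRight_tmul]
    have hr : counitRight k V ∘ₗ rightMul k V (DirectSum.lof k ℤ V i v) = 0 :=
      tensor_hom_ext fun j a ha b => by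
        rw [LinearMap.comp_apply, rightMul_tmul k V v ha, Units.smul_def, map_zsmul,
          counitRight_tmul, counit_ι_mul, zero_smul, smul_zero, LinearMap.zero_apply]
    rw [comul_ι_mul, map_add]
    have h1 := LinearMap.congr_fun hl (comul k V x)
    have h2 := LinearMap.congr_fun hr (comul k V x)
    simp only [LinearMap.comp_apply, LinearMap.zero_apply, LinearMap.mulLeft_apply] at h1 h2
    rw [h1, h2, hx, add_zero]

/-- The quadratic component of a corestriction, doubled, is `D` applied to the component of the
comultiplication in `V ⊗ V`. -/
theorem lift_proj_comul (D : (⨁ i, V i) →ₗ[k] (⨁ i, V i) →ₗ[k] ⨁ i, V i)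
    (hD : IsGradedSymmetric k D) (x : GradedSym k V) :
    TensorProduct.lift (D.compl₁₂ (proj k V) (proj k V)) (comul k V x) =
      (2 : k) • (truncation k D hD x).2.2 := by
  induction x using induction_ι_mul with
  | one => simp [comul_one, proj_one, truncation_one]
  | add x y hx hy => simp only [map_add, hx, hy, Prod.snd_add, smul_add]
  | smul c x hx => simp only [map_smul, hx, Prod.smul_snd, smul_comm c]
  | mul i v x _ =>
    have hl : TensorProduct.lift (D.compl₁₂ (proj k V) (proj k V)) ∘ₗ
        leftMul k V (DirectSum.lof k ℤ V i v) =
        D (DirectSum.lof k ℤ V i v) ∘ₗ proj k V ∘ₗ counitLeft k V :=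
      tensor_hom_ext fun j a ha b => by
        simp [leftMul_tmul, counitLeft_tmul, proj_ι_mul]
    -- Here `v` lands in the right factor: the Koszul sign from passing `a` is cancelled by the
    -- graded symmetry of `D`, which brings `v` back to the first argument.
    have hr : TensorProduct.lift (D.compl₁₂ (proj k V) (proj k V)) ∘ₗ
        rightMul k V (DirectSum.lof k ℤ V i v) =
        D (DirectSum.lof k ℤ V i v) ∘ₗ proj k V ∘ₗ counitRight k V :=
      tensor_hom_ext fun j a ha b => by
        obtain ⟨w, hw⟩ := exists_proj_eq k V ha
        rw [LinearMap.comp_apply, rightMul_tmul k V v ha, Units.smul_def, map_zsmul,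
          TensorProduct.lift.tmul, LinearMap.compl₁₂_apply, proj_ι_mul, hw, map_smul,
          LinearMap.comp_apply, LinearMap.comp_apply, counitRight_tmul, map_smul, hw, map_smul,
          hD i j v w, Units.smul_def, smul_comm]
    -- By the two counit axioms, each summand of the comultiplication contributes the same term `D v
    -- (proj x)`, hence the factor 2.
    rw [comul_ι_mul, map_add, truncation_ι_mul, truncation_snd_fst]
    have h1 := LinearMap.congr_fun hl (comul k V x)
    have h2 := LinearMap.congr_fun hr (comul k V x)
    simp only [LinearMap.comp_apply, counitLeft_comul, counitRight_comul] at h1 h2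
    rw [h1, h2, two_smul]

/-! ### Group-like series and their projections -/

variable {k V}

/-- The sequence `x 0, x 1, …` in a coalgebra `Sym V` is group-like: `∑ λⁿ xₙ` is a group-like
formal power series. -/
structure IsGroupLikeSeq (x : ℕ → GradedSym k V) : Prop where
  zero : x 0 = 1
  counit : ∀ n, n ≠ 0 → counit k V (x n) = 0
  comul : ∀ n, comul k V (x n) = ∑ p ∈ Finset.HasAntidiagonal.antidiagonal n, x p.1 ⊗ₜ[k] x p.2

theorem IsGroupLikeSeq.coderivation {x : ℕ → GradedSym k V} (hx : IsGroupLikeSeq x)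
    (q : GradedSym k V →ₗ[k] ⨁ i, V i) (n : ℕ) : coderivation k q (x n) =
      ∑ p ∈ Finset.HasAntidiagonal.antidiagonal n, ι k V (q (x p.1)) * x p.2 := by
  simp [GradedSym.coderivation, hx.comul]

/-- The summand `ι(q xₐ) x_b` projects to `ε(x_b) q(xₐ)`, which vanishes unless `b = 0`, where `x₀ =
1`. -/
theorem IsGroupLikeSeq.proj_coderivation {x : ℕ → GradedSym k V} (hx : IsGroupLikeSeq x)
    (q : GradedSym k V →ₗ[k] ⨁ i, V i) (n : ℕ) :
    proj k V (GradedSym.coderivation k q (x n)) = q (x n) := by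
  rw [hx.coderivation, map_sum, Finset.sum_eq_single (n, 0)]
  · simp [proj_ι, hx.zero]
  · rintro ⟨a, b⟩ hp hne
    have hb : b ≠ 0 := by
      rintro rfl
      exact hne (by simpa using hp)
    simp [proj_ι_mul, hx.counit b hb]
  · simp

/-- This is where the Maurer–Cartan expression `b y + ½ D(y, y)` comes from: `lift_proj_comul` is
applied to `Δ xₙ = ∑ xₐ ⊗ x_b`. Keeping the identity doubled avoids the fraction. -/
theorem IsGroupLikeSeq.corestriction [CharZero k] {x : ℕ → GradedSym k V} (hx : IsGroupLikeSeq x)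
    (b : (⨁ i, V i) →ₗ[k] ⨁ i, V i) (D : (⨁ i, V i) →ₗ[k] (⨁ i, V i) →ₗ[k] ⨁ i, V i)
    (hD : IsGradedSymmetric k D) (n : ℕ) :
    (2 : k) • corestriction k b D hD (x n) = (2 : k) • b (proj k V (x n)) +
      ∑ p ∈ Finset.HasAntidiagonal.antidiagonal n, D (proj k V (x p.1)) (proj k V (x p.2)) := by
  have h := lift_proj_comul k V D hD (x n)
  rw [hx.comul, map_sum] at h
  simp only [TensorProduct.lift.tmul, LinearMap.compl₁₂_apply] at h
  rw [h, ← smul_add]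
  rfl

/-! ### The exponential of a series of degree 0 -/

/-- The coefficients of the exponential of the series `∑ λⁿ⁺¹ vₙ`. -/
def expSeq (v : ℕ → V 0) : ℕ → GradedSym k V
  | 0 => 1
  | n + 1 => ((n + 1 : ℕ) : k)⁻¹ • ∑ i : Fin (n + 1),
      ((i + 1 : ℕ) : k) • (ι k V (DirectSum.lof k ℤ V 0 (v i)) * expSeq v (n - i))

/-- With `w = ∑ λⁿ⁺¹ vₙ` this is the coefficient form of the differential equation `E' = w' E`. The
weight `p + 1` appears because `v p` is the coefficient of `λ^(p + 1)`. Powers and factorials never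
occur. -/
theorem expSeq_succ [CharZero k] (v : ℕ → V 0) (n : ℕ) :
    ((n + 1 : ℕ) : k) • expSeq (k := k) v (n + 1) = ∑ p ∈ Finset.HasAntidiagonal.antidiagonal n,
      ((p.1 + 1 : ℕ) : k) • (ι k V (DirectSum.lof k ℤ V 0 (v p.1)) * expSeq v p.2) := by
  rw [expSeq, smul_smul, mul_inv_cancel₀ (Nat.cast_ne_zero.2 n.succ_ne_zero), one_smul,
    Finset.Nat.sum_antidiagonal_eq_sum_range_succ_mk, Finset.sum_range]

theorem counit_expSeq [CharZero k] (v : ℕ → V 0) {n : ℕ} (hn : n ≠ 0) :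
    counit k V (expSeq v n) = 0 := by
  obtain ⟨n, rfl⟩ := Nat.exists_eq_succ_of_ne_zero hn
  rw [expSeq]
  simp [counit_ι_mul, -map_mul]

/-- In the recursion only the term containing `E₀ = 1` survives the projection, as the other
coefficients have zero counit. The factor `n + 1` then cancels. -/
theorem proj_expSeq_succ [CharZero k] (v : ℕ → V 0) (n : ℕ) :
    proj k V (expSeq v (n + 1)) = DirectSum.lof k ℤ V 0 (v n) := by
  have h0 : ((n + 1 : ℕ) : k) ≠ 0 := Nat.cast_ne_zero.2 n.succ_ne_zero
  refine smul_right_injective _ h0 ?_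
  dsimp only
  rw [← map_smul, expSeq_succ, map_sum, Finset.sum_eq_single (n, 0)]
  · simp [proj_ι, expSeq]
  · rintro ⟨a, b⟩ hp hne
    have hb : b ≠ 0 := by
      rintro rfl
      exact hne (by simpa using hp)
    simp [proj_ι_mul, counit_expSeq v hb]
  · simp

theorem sum_antidiagonal_succ_smul {W : Type*} [AddCommGroup W] [Module k W] (n : ℕ)
    (f : ℕ → ℕ → W) : ∑ p ∈ Finset.HasAntidiagonal.antidiagonal (n + 1), (p.1 : k) • f p.1 p.2 =
      ∑ p ∈ Finset.HasAntidiagonal.antidiagonal n, ((p.1 + 1 : ℕ) : k) • f (p.1 + 1) p.2 := by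
  rw [Finset.Nat.sum_antidiagonal_succ]
  simp

/-- Both `Δ E` and `E ⊗ E` solve `F' = (w' ⊗ 1 + 1 ⊗ w') F` with `F₀ = 1 ⊗ 1`, and in characteristic
0 this equation determines all coefficients. No Koszul signs appear because the generators have
degree 0. -/
theorem comul_expSeq [CharZero k] (v : ℕ → V 0) (n : ℕ) :
    comul k V (expSeq v n) =
      ∑ p ∈ Finset.HasAntidiagonal.antidiagonal n, expSeq v p.1 ⊗ₜ[k] expSeq v p.2 := by
  induction n using Nat.strong_induction_on with
  | _ n ih =>
  cases n with
  | zero => simp [expSeq, comul_one]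
  | succ n =>
    have h0 : ((n + 1 : ℕ) : k) ≠ 0 := Nat.cast_ne_zero.2 n.succ_ne_zero
    refine smul_right_injective _ h0 ?_
    dsimp only
    rw [← map_smul, expSeq_succ, map_sum]
    -- The equation for `Δ E`: the two sums come from the two halves of a primitive element.
    have e1 : ∀ p ∈ Finset.HasAntidiagonal.antidiagonal n, comul k V (((p.1 + 1 : ℕ) : k) •
        (ι k V (DirectSum.lof k ℤ V 0 (v p.1)) * expSeq v p.2)) =
        ∑ q ∈ Finset.HasAntidiagonal.antidiagonal p.2, (((p.1 + 1 : ℕ) : k) •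
          (ι k V (DirectSum.lof k ℤ V 0 (v p.1)) * expSeq v q.1)) ⊗ₜ[k] expSeq v q.2 +
        ∑ q ∈ Finset.HasAntidiagonal.antidiagonal p.2, expSeq v q.1 ⊗ₜ[k] (((p.1 + 1 : ℕ) : k) •
          (ι k V (DirectSum.lof k ℤ V 0 (v p.1)) * expSeq v q.2)) := by
      intro p hp
      have hlt := Finset.HasAntidiagonal.mem_antidiagonal.1 hp
      rw [map_smul, comul_ι_mul, ih p.2 (by omega)]
      simp only [map_sum, leftMul_tmul, rightMul_tmul_of_degree_zero, smul_add, Finset.smul_sum,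
        TensorProduct.smul_tmul', TensorProduct.tmul_smul]
    -- The Leibniz rule for `λ d/dλ` on `E ⊗ E`: the weight `n + 1` of a pair is the sum of the
    -- weights of its entries. The second sum is written with its indices swapped, so that
    -- `sum_antidiagonal_succ_smul` applies to both.
    have e2 : ((n + 1 : ℕ) : k) •
        ∑ p ∈ Finset.HasAntidiagonal.antidiagonal (n + 1),
          expSeq (k := k) v p.1 ⊗ₜ[k] expSeq (k := k) v p.2 =
        ∑ p ∈ Finset.HasAntidiagonal.antidiagonal (n + 1),
          (p.1 : k) • (expSeq (k := k) v p.1 ⊗ₜ[k] expSeq v p.2) +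
        ∑ p ∈ Finset.HasAntidiagonal.antidiagonal (n + 1),
          (p.1 : k) • (expSeq (k := k) v p.2 ⊗ₜ[k] expSeq v p.1) := by
      rw [← Finset.Nat.sum_antidiagonal_swap (n := n + 1) (f := fun p : ℕ × ℕ =>
        (p.1 : k) • (expSeq (k := k) v p.2 ⊗ₜ[k] expSeq v p.1)), ← Finset.sum_add_distrib,
        Finset.smul_sum]
      refine Finset.sum_congr rfl fun p hp => ?_
      rw [← Finset.HasAntidiagonal.mem_antidiagonal.1 hp, Nat.cast_add, add_smul]
      rfl
    rw [Finset.sum_congr rfl e1, Finset.sum_add_distrib, e2,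
      sum_antidiagonal_succ_smul (k := k) n fun a b => expSeq (k := k) v a ⊗ₜ[k] expSeq v b,
      sum_antidiagonal_succ_smul (k := k) n fun a b => expSeq (k := k) v b ⊗ₜ[k] expSeq v a]
    simp only [← TensorProduct.tmul_smul (R := k)]
    congr 1
    · simp only [TensorProduct.tmul_smul, TensorProduct.smul_tmul', expSeq_succ,
        TensorProduct.sum_tmul]
      exact sum_antidiagonal_assoc n fun a b c => (((a + 1 : ℕ) : k) •
        (ι k V (DirectSum.lof k ℤ V 0 (v a)) * expSeq v b)) ⊗ₜ[k] expSeq v c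
    · simp only [expSeq_succ, TensorProduct.tmul_sum]
      rw [← sum_antidiagonal_assoc n fun a b c => expSeq (k := k) v c ⊗ₜ[k] (((a + 1 : ℕ) : k) •
        (ι k V (DirectSum.lof k ℤ V 0 (v a)) * expSeq v b))]
      refine Finset.sum_congr rfl fun p _ => ?_
      rw [← Finset.Nat.sum_antidiagonal_swap]
      rfl

/-- Needed so that a degree 0 morphism maps the exponential into degree 0 of `Sym(C[2])`, whose
projections are 2-cochains. -/
theorem expSeq_mem_grading (v : ℕ → V 0) (n : ℕ) : expSeq v n ∈ grading k V 0 := by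
  induction n using Nat.strong_induction_on with
  | _ n ih =>
  cases n with
  | zero => rw [expSeq]; exact SetLike.GradedOne.one_mem
  | succ n =>
    rw [expSeq]
    refine Submodule.smul_mem _ _ (Submodule.sum_mem _ fun i _ => Submodule.smul_mem _ _ ?_)
    exact SetLike.GradedMul.mul_mem (i := (0 : ℤ)) (j := 0) (ι_mem k V 0 _) (ih _ (by omega))

theorem isGroupLikeSeq_expSeq [CharZero k] (v : ℕ → V 0) :
    IsGroupLikeSeq (expSeq (k := k) v) :=
  ⟨by rw [expSeq], fun _ => counit_expSeq v, comul_expSeq v⟩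

end
end GradedSym

/-! ### Transport of Maurer–Cartan elements by the formality map -/

noncomputable section

open GradedSym DirectSum

variable {k A : Type*} [Field k] [CommRing A] [Algebra k A]

/-- The shift sign `(-1)^0` is trivial, so on `H²` the shifted bracket is the bracket itself; the
remaining index arithmetic holds by evaluation. -/
theorem shiftedCohomologyBracket_zero_zero (x y : HarrisonCohomology k A 2) :
    shiftedCohomologyBracket k A (lof k ℤ (ShiftedCohomology k A) 0 x)
      (lof k ℤ (ShiftedCohomology k A) 0 y) =
    lof k ℤ (ShiftedCohomology k A) 1
      (cohomologyBracket k A (show (2 : ℤ) + 2 = 3 + 1 by norm_num) x y) := by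
  rw [shiftedCohomologyBracket, totalBilinear_lof]
  simp only [Int.negOnePow_zero, Units.val_one, Int.cast_one, one_smul]
  rfl

theorem shiftedCochainBracket_zero_zero (x y : harrisonCochains k A 2) :
    shiftedCochainBracket k A (lof k ℤ (ShiftedCochains k A) 0 x)
      (lof k ℤ (ShiftedCochains k A) 0 y) =
    lof k ℤ (ShiftedCochains k A) 1
      (cochainBracket (show (2 : ℤ) + 2 = 3 + 1 by norm_num) x y) := by
  rw [shiftedCochainBracket, totalBilinear_lof]
  simp only [Int.negOnePow_zero, Units.val_one, Int.cast_one, one_smul]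
  rfl

theorem shiftedDifferential_zero (x : harrisonCochains k A 2) :
    shiftedDifferential k A (lof k ℤ (ShiftedCochains k A) 0 x) =
      lof k ℤ (ShiftedCochains k A) 1 (differential k A (show (2 : ℤ) + 1 = 3 by norm_num) x) := by
  rw [shiftedDifferential, toModule_lof]
  rfl

/-- The exponential of a Maurer–Cartan element of `λ H[2]⁰[[λ]]` is closed. -/
theorem cohomologyCodifferential_expSeq [CharZero k] (π : ℕ → HarrisonCohomology k A 2)
    (hπ : ∀ n, ∑ p ∈ Finset.HasAntidiagonal.antidiagonal n,
      cohomologyBracket k A (show (2 : ℤ) + 2 = 3 + 1 by norm_num) (π p.1) (π p.2) = 0) (n : ℕ) :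
    cohomologyCodifferential k A (expSeq (k := k) (V := ShiftedCohomology k A) π n) = 0 := by
  have hE := isGroupLikeSeq_expSeq (k := k) (V := ShiftedCohomology k A) π
  have hq : ∀ n, corestriction k 0 (shiftedCohomologyBracket k A)
      (shiftedCohomologyBracket_symm k A)
      (expSeq (k := k) (V := ShiftedCohomology k A) π n) = 0 := by
    intro n
    refine (smul_eq_zero.1 ?_).resolve_left (two_ne_zero (α := k))
    rw [hE.corestriction, LinearMap.zero_apply, smul_zero, zero_add]
    have h0 : proj k _ (expSeq (k := k) (V := ShiftedCohomology k A) π 0) = 0 := by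
      rw [hE.zero, proj_one]
    rcases n with _ | _ | n
    · simp [h0]
    · simp [Finset.Nat.antidiagonal_succ, h0]
    -- The two extreme pairs contain `E₀`, whose projection is 0. The coefficient of `λ^(p + 1)`
    -- projects to `π p`, so order `n + 2` carries the hypothesis of index `n`.
    · rw [Finset.Nat.antidiagonal_succ_succ']
      simp only [Finset.sum_cons, Finset.sum_map, h0, map_zero, LinearMap.zero_apply, zero_add]
      rw [← map_zero (lof k ℤ (ShiftedCohomology k A) 1), ← hπ n, map_sum]
      refine Finset.sum_congr rfl fun p _ => ?_
      change shiftedCohomologyBracket k A (proj k _ (expSeq π (p.1 + 1)))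
        (proj k _ (expSeq π (p.2 + 1))) = _
      rw [proj_expSeq_succ, proj_expSeq_succ]
      exact shiftedCohomologyBracket_zero_zero _ _
  rw [cohomologyCodifferential, hE.coderivation]
  simp [hq]

/-- An `L_∞`-morphism sends the exponential of a Maurer–Cartan element to the exponential of a
Maurer–Cartan element. -/
theorem exists_maurerCartan [CharZero k] (hA : IsHarrisonFormal k A)
    (π : ℕ → HarrisonCohomology k A 2)
    (hπ : ∀ n, ∑ p ∈ Finset.HasAntidiagonal.antidiagonal n,
      cohomologyBracket k A (show (2 : ℤ) + 2 = 3 + 1 by norm_num) (π p.1) (π p.2) = 0) :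
    ∃ y : ℕ → harrisonCochains k A 2, y 0 = 0 ∧
      (∀ n, (2 : k) • differential k A (show (2 : ℤ) + 1 = 3 by norm_num) (y n) +
        ∑ p ∈ Finset.HasAntidiagonal.antidiagonal n,
          cochainBracket (show (2 : ℤ) + 2 = 3 + 1 by norm_num) (y p.1) (y p.2) = 0) ∧
      ∃ z : harrisonCocycles k A 2, z.1 = y 1 ∧ cohomologyClass k A 2 z = π 0 := by
  obtain ⟨Φ, hΦ⟩ := hA
  have hE := isGroupLikeSeq_expSeq (k := k) (V := ShiftedCohomology k A) π
  have hcl := cohomologyCodifferential_expSeq π hπ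
  have h1 : expSeq (k := k) (V := ShiftedCohomology k A) π 1 =
      ι k _ (lof k ℤ (ShiftedCohomology k A) 0 (π 0)) := by
    simp [expSeq]
  have hE0 : ∀ n, expSeq (k := k) (V := ShiftedCohomology k A) π n ∈
      grading k (ShiftedCohomology k A) 0 := expSeq_mem_grading _
  -- From here on only group-likeness, closedness, degree 0 and the linear coefficient of the
  -- exponential matter.
  generalize expSeq (k := k) (V := ShiftedCohomology k A) π = E at *
  -- Morphisms of coaugmented coalgebras preserve group-like series.
  have hG : IsGroupLikeSeq fun n => Φ (E n) :=
    { zero := by rw [hE.zero, hΦ.map_one]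
      counit := fun n hn => by rw [hΦ.counit_comp, hE.counit n hn]
      comul := fun n => by
        have := LinearMap.congr_fun hΦ.comul_comp (E n)
        simp only [LinearMap.comp_apply, hE.comul, map_sum, TensorProduct.map_tmul] at this
        exact this.symm }
  choose y hy using fun n => exists_proj_eq k _ (hΦ.degree_zero 0 _ (hE0 n))
  have hinj : ∀ i, Function.Injective (lof k ℤ (ShiftedCochains k A) i) :=
    fun i => DirectSum.of_injective i
  refine ⟨y, ?_, fun n => ?_, ?_⟩
  · refine hinj 0 ?_
    rw [← hy, hE.zero, hΦ.map_one, proj_one, map_zero]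
  · have hq := hG.proj_coderivation (GradedSym.corestriction k (shiftedDifferential k A)
      (shiftedCochainBracket k A) (shiftedCochainBracket_symm k A)) n
    have hcod := LinearMap.congr_fun hΦ.codifferential_comp (E n)
    rw [LinearMap.comp_apply, LinearMap.comp_apply, hcl, map_zero] at hcod
    have hcor := hG.corestriction (shiftedDifferential k A)
      (shiftedCochainBracket k A) (shiftedCochainBracket_symm k A) n
    -- The image is annihilated by the codifferential, so its corestriction vanishes in every order;
    -- doubled, this is the Maurer–Cartan equation for `y`.
    rw [← hq, show coderivation k _ (Φ (E n)) = 0 from hcod, map_zero, smul_zero] at hcor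
    simp only [hy] at hcor
    refine hinj 1 ?_
    rw [map_zero, hcor, map_add, map_smul, map_sum]
    refine congrArg₂ _ (congrArg _ (shiftedDifferential_zero _).symm)
      (Finset.sum_congr rfl fun p _ => (shiftedCochainBracket_zero_zero _ _).symm)
  -- The linear coefficient of the exponential is `π 0` itself, so `y 1` is the representative
  -- `Φ₁(π₀)` supplied by the section property.
  · obtain ⟨z, hz, hz'⟩ := hΦ.isSection 0 (π 0)
    refine ⟨z, hinj 0 ?_, hz⟩
    rw [← hy, h1]
    exact hz'.symm

end

/-! ### Harrison 2-cochains as commutative products -/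

noncomputable section

variable {k A : Type*} [Field k] [CommRing A] [Algebra k A]

/-- A Harrison 2-cochain as a bilinear map. -/
def toBilinear (f : harrisonCochains k A 2) : A →ₗ[k] A →ₗ[k] A :=
  LinearMap.mk₂ k (fun a b => f.1 [a, b])
    (fun a a' b => f.2.1.1.map_add [] a a' [b]) (fun c a b => f.2.1.1.map_smul [] c a [b])
    (fun a b b' => f.2.1.1.map_add [a] b b' []) (fun c a b => f.2.1.1.map_smul [a] c b [])

theorem toBilinear_apply (f : harrisonCochains k A 2) (a b : A) :
    toBilinear f a b = f.1 [a, b] := rfl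

theorem bilinearCochain_toBilinear (f : harrisonCochains k A 2) :
    bilinearCochain (toBilinear f) = f.1 := by
  funext l
  match l with
  | [] => exact (f.2.1.2 [] (by simp)).symm
  | [_] => exact (f.2.1.2 _ (by simp)).symm
  | [_, _] => rfl
  | _ :: _ :: _ :: l => exact (f.2.1.2 _ (by simp; omega)).symm

/-- The signed shuffle of two letters is `ab - ba`, so in degree 2 the Harrison condition is
precisely symmetry. -/
theorem toBilinear_comm (f : harrisonCochains k A 2) (a b : A) :
    toBilinear f a b = toBilinear f b a := by
  have h := f.2.2 [a] [b] (List.cons_ne_nil _ _) (List.cons_ne_nil _ _)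
  rw [onShuffle_cons, onShuffle_nil_left, onShuffle_nil_right] at h
  simp only [List.length_nil, zero_add, pow_one, neg_mul, one_mul] at h
  exact sub_eq_zero.1 ((sub_eq_add_neg _ _).trans h)

/-- Only blocks of length 2 inserted at positions 0 and 1 contribute, with opposite signs, so the
composition is a polarised associator. -/
theorem circ_toBilinear (f g : harrisonCochains k A 2) (a b c : A) :
    circ f.1 g.1 [a, b, c] =
      toBilinear f (toBilinear g a b) c - toBilinear f a (toBilinear g b c) := by
  have hf : ∀ l : List A, l.length ≠ 2 → f.1 l = 0 := fun l hl => f.2.1.2 l (by omega)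
  have hg : ∀ l : List A, l.length ≠ 2 → g.1 l = 0 := fun l hl => g.2.1.2 l (by omega)
  simp [circ, Finset.sum_range_succ, toBilinear_apply, hf, hg]
  ring

/-- Two-cochains are odd for the Lie grading, so on them the bracket is symmetric. -/
theorem cochainBracket_two_two (h : (2 : ℤ) + 2 = 3 + 1) (f g : harrisonCochains k A 2) :
    (cochainBracket h f g).1 = circ f.1 g.1 + circ g.1 f.1 := by
  change circ f.1 g.1 - ((2 - 1 : ℤ) * (2 - 1)).negOnePow • circ g.1 f.1 = _
  simp [Units.smul_def]

/-- Summed over an antidiagonal, the two compositions in each bracket give equal totals, so the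
bracket sum is twice the composition sum and 2 is invertible. -/
theorem sum_circ_eq_zero [CharZero k] (m : ℕ → harrisonCochains k A 2) (n : ℕ)
    (h : ∑ p ∈ Finset.HasAntidiagonal.antidiagonal n,
      cochainBracket (show (2 : ℤ) + 2 = 3 + 1 by norm_num) (m p.1) (m p.2) = 0) :
    ∑ p ∈ Finset.HasAntidiagonal.antidiagonal n, circ (m p.1).1 (m p.2).1 = 0 := by
  have h' := congrArg Subtype.val h
  rw [AddSubmonoidClass.coe_finsetSum] at h'
  simp only [cochainBracket_two_two, Finset.sum_add_distrib] at h'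
  rw [← Finset.Nat.sum_antidiagonal_swap (f := fun p : ℕ × ℕ => circ (m p.2).1 (m p.1).1)] at h'
  refine (smul_eq_zero.1 ?_).resolve_left (two_ne_zero (α := k))
  rw [two_smul]
  exact h'

/-- The Maurer–Cartan equation for `y` says that `μ₀ + y` has square zero. -/
theorem sum_bracket_eq_zero (y : ℕ → harrisonCochains k A 2) (h0 : y 0 = 0)
    (hy : ∀ n, (2 : k) • differential k A (show (2 : ℤ) + 1 = 3 by norm_num) (y n) +
      ∑ p ∈ Finset.HasAntidiagonal.antidiagonal n,
        cochainBracket (show (2 : ℤ) + 2 = 3 + 1 by norm_num) (y p.1) (y p.2) = 0)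
    (m : ℕ → harrisonCochains k A 2) (hm0 : m 0 = ⟨mulCochain A, mulCochain_mem k A⟩)
    (hm : ∀ n, m (n + 1) = y (n + 1)) (n : ℕ) :
    ∑ p ∈ Finset.HasAntidiagonal.antidiagonal n,
      cochainBracket (show (2 : ℤ) + 2 = 3 + 1 by norm_num) (m p.1) (m p.2) = 0 := by
  -- The differential is bracketing with `μ₀` on the left; symmetry in degree 2 gives the same with
  -- `μ₀` on the right.
  have hs : ∀ f, cochainBracket (show (2 : ℤ) + 2 = 3 + 1 by norm_num) f (m 0) =
      differential k A (show (2 : ℤ) + 1 = 3 by norm_num) f := by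
    intro f
    rw [hm0]
    refine Subtype.ext ?_
    rw [cochainBracket_two_two, add_comm, ← cochainBracket_two_two]
    rfl
  have hs' : ∀ f, cochainBracket (show (2 : ℤ) + 2 = 3 + 1 by norm_num) (m 0) f =
      differential k A (show (2 : ℤ) + 1 = 3 by norm_num) f := by
    intro f
    rw [hm0]
    rfl
  rcases n with _ | _ | n
  · simp [hm0, mul_bracket_mul]
  · have := hy 1
    simp only [Finset.Nat.sum_antidiagonal_succ, Finset.Nat.antidiagonal_zero,
      Finset.sum_singleton, zero_add, h0, map_zero, LinearMap.zero_apply, add_zero] at this ⊢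
    rw [hs, hs', hm, ← two_smul k]
    exact this
  -- The two extreme pairs are brackets with `μ₀` and supply the doubled differential. In the
  -- equation for `y` the same pairs vanish since `y 0 = 0`, while the interior pairs agree.
  · have := hy (n + 2)
    rw [Finset.Nat.antidiagonal_succ_succ', Finset.sum_cons, Finset.sum_cons,
      Finset.sum_map] at this ⊢
    simp only [h0, map_zero, LinearMap.zero_apply, zero_add, two_smul] at this
    rw [hs, hs', hm, ← add_assoc, ← this]
    refine congrArg₂ _ rfl (Finset.sum_congr rfl fun p _ => ?_)
    exact congrArg₂ (fun f g => cochainBracket _ f g) (hm _) (hm _)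

/-! ### Commutativity and associativity of the star product -/

theorem coeff_starProduct (μ : ℕ → A →ₗ[k] A →ₗ[k] A) (F G : PowerSeries A) (n : ℕ) :
    PowerSeries.coeff n (starProduct μ F G) = ∑ p ∈ Finset.HasAntidiagonal.antidiagonal n,
      ∑ q ∈ Finset.HasAntidiagonal.antidiagonal p.2,
        μ p.1 (PowerSeries.coeff q.1 F) (PowerSeries.coeff q.2 G) :=
  PowerSeries.coeff_mk _ _

theorem starProduct_comm (μ : ℕ → A →ₗ[k] A →ₗ[k] A) (hμ : ∀ n a b, μ n a b = μ n b a)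
    (F G : PowerSeries A) : starProduct μ F G = starProduct μ G F := by
  ext n
  rw [coeff_starProduct, coeff_starProduct]
  refine Finset.sum_congr rfl fun p _ => ?_
  rw [← Finset.Nat.sum_antidiagonal_swap]
  exact Finset.sum_congr rfl fun q _ => hμ _ _ _

/-- Each coefficient is a sum over quintuples: the orders of the two products and the coefficient
indices of `F`, `G` and `K`. With those three indices fixed, the sum over the two product orders is
the hypothesis for their total. -/
theorem starProduct_assoc (μ : ℕ → A →ₗ[k] A →ₗ[k] A)
    (hμ : ∀ n a b c, ∑ p ∈ Finset.HasAntidiagonal.antidiagonal n, μ p.1 (μ p.2 a b) c =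
      ∑ p ∈ Finset.HasAntidiagonal.antidiagonal n, μ p.1 a (μ p.2 b c))
    (F G K : PowerSeries A) :
    starProduct μ (starProduct μ F G) K = starProduct μ F (starProduct μ G K) := by
  ext n
  have hl : PowerSeries.coeff n (starProduct μ (starProduct μ F G) K) =
      ∑ p ∈ Finset.HasAntidiagonal.antidiagonal n, ∑ q ∈ Finset.HasAntidiagonal.antidiagonal p.2,
        ∑ t ∈ Finset.HasAntidiagonal.antidiagonal q.2,
          ∑ s ∈ Finset.HasAntidiagonal.antidiagonal p.1, μ s.1 (μ s.2 (PowerSeries.coeff q.1 F)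
            (PowerSeries.coeff t.1 G)) (PowerSeries.coeff t.2 K) := by
    simp only [coeff_starProduct, map_sum, LinearMap.sum_apply, Finset.sum_sigma']
    -- The reindexing collects the outer and inner product orders in the pair `s`, with total `p.1`,
    -- and distributes `p.2` among the coefficient indices of `F`, `G` and `K`.
    refine Finset.sum_nbij'
      (fun x => ⟨(x.1.1 + x.2.2.1.1, x.2.2.2.1 + (x.2.2.2.2 + x.2.1.2)),
        (x.2.2.2.1, x.2.2.2.2 + x.2.1.2), (x.2.2.2.2, x.2.1.2), (x.1.1, x.2.2.1.1)⟩)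
      (fun x => ⟨(x.2.2.2.1, (x.2.2.2.2 + (x.2.1.1 + x.2.2.1.1)) + x.2.2.1.2),
        (x.2.2.2.2 + (x.2.1.1 + x.2.2.1.1), x.2.2.1.2),
        (x.2.2.2.2, x.2.1.1 + x.2.2.1.1), (x.2.1.1, x.2.2.1.1)⟩) ?_ ?_ ?_ ?_ fun _ _ => rfl
    all_goals
      rintro ⟨⟨a, b⟩, ⟨c, d⟩, ⟨e, f⟩, ⟨g, h⟩⟩ hx
      simp only [Finset.mem_sigma, Finset.HasAntidiagonal.mem_antidiagonal] at hx ⊢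
      obtain ⟨rfl, rfl, rfl, rfl⟩ := hx
      simp [add_assoc]
  have hr : PowerSeries.coeff n (starProduct μ F (starProduct μ G K)) =
      ∑ p ∈ Finset.HasAntidiagonal.antidiagonal n, ∑ q ∈ Finset.HasAntidiagonal.antidiagonal p.2,
        ∑ t ∈ Finset.HasAntidiagonal.antidiagonal q.2,
          ∑ s ∈ Finset.HasAntidiagonal.antidiagonal p.1, μ s.1 (PowerSeries.coeff q.1 F)
            (μ s.2 (PowerSeries.coeff t.1 G) (PowerSeries.coeff t.2 K)) := by
    simp only [coeff_starProduct, map_sum, Finset.sum_sigma']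
    refine Finset.sum_nbij'
      (fun x => ⟨(x.1.1 + x.2.2.1.1, x.2.1.1 + (x.2.2.2.1 + x.2.2.2.2)),
        (x.2.1.1, x.2.2.2.1 + x.2.2.2.2), (x.2.2.2.1, x.2.2.2.2), (x.1.1, x.2.2.1.1)⟩)
      (fun x => ⟨(x.2.2.2.1, x.2.1.1 + (x.2.2.2.2 + (x.2.2.1.1 + x.2.2.1.2))),
        (x.2.1.1, x.2.2.2.2 + (x.2.2.1.1 + x.2.2.1.2)),
        (x.2.2.2.2, x.2.2.1.1 + x.2.2.1.2), (x.2.2.1.1, x.2.2.1.2)⟩) ?_ ?_ ?_ ?_ fun _ _ => rfl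
    all_goals
      rintro ⟨⟨a, b⟩, ⟨c, d⟩, ⟨e, f⟩, ⟨g, h⟩⟩ hx
      simp only [Finset.mem_sigma, Finset.HasAntidiagonal.mem_antidiagonal] at hx ⊢
      obtain ⟨rfl, rfl, rfl, rfl⟩ := hx
      simp [add_assoc, add_left_comm]
  rw [hl, hr]
  refine Finset.sum_congr rfl fun p _ => Finset.sum_congr rfl fun q _ =>
    Finset.sum_congr rfl fun t _ => hμ _ _ _ _

end
end Harrison

/-! ### Proof of the theorem -/

theorem mainTheorem1 {k A : Type*} [Field k] [CharZero k] [CommRing A] [Algebra k A]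
    (hA : Harrison.IsHarrisonFormal k A) (π : ℕ → Harrison.HarrisonCohomology k A 2)
    (hπ : ∀ n, ∑ p ∈ Finset.HasAntidiagonal.antidiagonal n,
      Harrison.cohomologyBracket k A (show (2 : ℤ) + 2 = 3 + 1 by norm_num) (π p.1) (π p.2) = 0) :
    ∃ μ : ℕ → A →ₗ[k] A →ₗ[k] A, Harrison.IsFormalCommDeformation μ ∧
      ∃ z : Harrison.harrisonCocycles k A 2,
        z.1.1 = Harrison.bilinearCochain (μ 1) ∧ Harrison.cohomologyClass k A 2 z = π 0 := by
  obtain ⟨y, hy0, hy, z, hz, hzπ⟩ := Harrison.exists_maurerCartan hA π hπ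
  -- As `y 0 = 0`, this sequence is `μ₀ + y`.
  let m : ℕ → Harrison.harrisonCochains k A 2
    | 0 => ⟨Harrison.mulCochain A, Harrison.mulCochain_mem k A⟩
    | n + 1 => y (n + 1)
  have hm := fun n => Harrison.sum_circ_eq_zero m n
    (Harrison.sum_bracket_eq_zero y hy0 hy m rfl (fun _ => rfl) n)
  refine ⟨fun n => Harrison.toBilinear (m n), ⟨?_, ?_, ?_⟩, z, ?_, hzπ⟩
  · ext a b
    rfl
  · exact Harrison.starProduct_comm _ fun n => Harrison.toBilinear_comm (m n)
  · refine Harrison.starProduct_assoc _ fun n a b c => ?_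
    -- On three-letter words the vanishing composition sum is the associativity condition of order
    -- `n`.
    have := congrFun (hm n) [a, b, c]
    rw [Finset.sum_apply, Finset.sum_congr rfl fun p _ => Harrison.circ_toBilinear _ _ a b c,
      Finset.sum_sub_distrib] at this
    exact sub_eq_zero.1 this
  · rw [Harrison.bilinearCochain_toBilinear, hz]
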